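/- Let $\varepsilon>0$ and let $G(k)$ be an $N\times N$ matrix function on the strip $S=\{|\operatorname{Im}k|<\varepsilon\}$ which is algebraic (each entry satisfies an equation $P(k,G_{ij}(k))=0$ with a nonzero polynomial $P\in\mathbb{C}[k][y]$) and whose determinant is not identically zero. Suppose that $Q^+(k)$ and $Q^-(k)$ are analytic, except possibly for isolated poles, and of algebraic growth (all entries are $O(|k|^l)$ as $k\to\infty$, for some $l$) in the half-planes $U^+=\{\operatorname{Im}k>-\varepsilon\}$ and $U^-=\{\operatorname{Im}k<\varepsilon\}$, respectively, and that $G(k)=Q^+(k)Q^-(k)$ on $S$ (as an identity of meromorphic functions). The Riemann surface of a meromorphic matrix function on a connected domain is the set of all function elements obtained from its germs by analytic continuation: the ordinary elements (meromorphic germs at points $k_0\in\mathbb{C}$) and the algebraically branched elements $F(k_0+z^m)=h(z)$, with $h$ meromorphic at $z=0$ and $m$ distinct branches; $k_0$ is called the affix and $m$ the order of the point. Poles are allowed, and the elements with $m\ge2$ are the branch points. Let $T$ be the set of affixes $\tau_i^{\pm}$ of all branch points of the Riemann surface of $G$ (over $\mathbb{C}$, on all sheets), and for $\tau\in T$ let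 $n(\tau)$ (written $n_i^\pm$ for $\tau=\tau_i^\pm$) be the least common multiple of the orders of all branch points of $G$ with affix $\tau$. Then $Q^+$ and $Q^-$ continue analytically onto (connected) Riemann surfaces over $\mathbb{C}$ with the following properties, for $Q=Q^+$ and for $Q=Q^-$: 1. from every point of the Riemann surface of $Q$, the function $Q$ can be continued, meromorphically, along every path $\gamma:[0,1]\to\mathbb{C}$ that starts at the affix of this point and satisfies $\gamma(t)\notin T$ for $0<t<1$; if $\gamma(1)\in T$, then the continuation ends in a point (of finite order, possibly $1$) of the Riemann surface of $Q$; 2. every branch point of the Riemann surface of $Q$ has its affix in $T$; 3. the order of every branch point of the Riemann surface of $Q$ with affix $\tau$ divides $n(\tau)$, which is a (finite) positive integer. -/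

import Mathlib

open Filter Topology

/-- A matrix function is meromorphic at `k` if all its entries are.
As usual in Mathlib, the values taken at the singular points themselves are irrelevant. -/
def MatMeromorphicAt {N : ℕ} (F : ℂ → Matrix (Fin N) (Fin N) ℂ) (k : ℂ) : Prop :=
  ∀ i j, MeromorphicAt (fun z => F z i j) k

/-! ### Function elements and Riemann surfaces of analytic matrix functions -/

/-- A (possibly branched) function element with centre `affix` and order `order = m`, given through
a local parameter `z`: the element is the multivalued function `F` with
`F (affix + z ^ m) = toFun z` near `z = 0`, where `toFun` is meromorphic at `0`.
The condition `primitive` says that the `m` branches are pairwise distinct, i.e. that `m` is the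
true order. Elements with `m = 1` are the ordinary meromorphic germs. -/
structure FunctionElement (N : ℕ) where
  affix : ℂ
  order : ℕ
  order_pos : 0 < order
  toFun : ℂ → Matrix (Fin N) (Fin N) ℂ
  meromorphic : MatMeromorphicAt toFun 0
  primitive : ∀ ζ : ℂ, ζ ^ order = 1 →
    (∀ᶠ z in 𝓝[≠] (0 : ℂ), toFun (ζ * z) = toFun z) → ζ = 1

namespace FunctionElement

variable {N : ℕ}

/-- Two function elements are the same point of a Riemann surface if their germs differ only by the
choice of the local parameter, `z` being replaced by `ζ * z` with a root of unity `ζ`. -/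
def Equivalent (e e' : FunctionElement N) : Prop :=
  e.affix = e'.affix ∧ e.order = e'.order ∧
    ∃ ζ : ℂ, ζ ^ e.order = 1 ∧ ∀ᶠ z in 𝓝[≠] (0 : ℂ), e'.toFun z = e.toFun (ζ * z)

theorem tendsto_mul_punctured {ζ : ℂ} (hζ : ζ ≠ 0) :
    Tendsto (fun z : ℂ => ζ * z) (𝓝[≠] 0) (𝓝[≠] 0) := by
  refine tendsto_nhdsWithin_iff.2 ⟨?_, ?_⟩
  · have h : Continuous fun z : ℂ => ζ * z := by fun_prop
    have h0 : Tendsto (fun z : ℂ => ζ * z) (𝓝 0) (𝓝 0) := by simpa using h.tendsto 0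
    exact h0.mono_left nhdsWithin_le_nhds
  · filter_upwards [self_mem_nhdsWithin] with z hz
    exact mul_ne_zero hζ hz

theorem ne_zero_of_pow_eq_one (e : FunctionElement N) {ζ : ℂ} (h : ζ ^ e.order = 1) : ζ ≠ 0 := by
  rintro rfl
  rw [zero_pow e.order_pos.ne'] at h
  exact zero_ne_one h

instance setoid (N : ℕ) : Setoid (FunctionElement N) where
  r := Equivalent
  iseqv :=
    { refl := fun e => ⟨rfl, rfl, 1, one_pow _, by simp⟩
      symm := by
        rintro e e' ⟨ha, ho, ζ, hζ, h⟩
        have h0 : ζ ≠ 0 := e.ne_zero_of_pow_eq_one hζ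
        refine ⟨ha.symm, ho.symm, ζ⁻¹, by rw [← ho, inv_pow, hζ, inv_one], ?_⟩
        filter_upwards [(tendsto_mul_punctured (inv_ne_zero h0)).eventually h] with z hz
        rw [hz, mul_inv_cancel_left₀ h0]
      trans := by
        rintro e e' e'' ⟨ha, ho, ζ, hζ, h⟩ ⟨ha', ho', ζ', hζ', h'⟩
        refine ⟨ha.trans ha', ho.trans ho', ζ * ζ', by rw [mul_pow, hζ, ho, hζ', one_mul], ?_⟩
        filter_upwards [h', (tendsto_mul_punctured (e'.ne_zero_of_pow_eq_one hζ')).eventually h]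
          with z hz hz'
        rw [hz, hz', mul_assoc] }

/-- `e.HasBranchAt z e'`: the ordinary germ `e'` is the branch of the element `e` at the value `z` of
the local parameter; it has the affix `e.affix + z ^ e.order`. (It is used for small `z ≠ 0`.) -/
def HasBranchAt (e : FunctionElement N) (z : ℂ) (e' : FunctionElement N) : Prop :=
  e'.order = 1 ∧ e'.affix = e.affix + z ^ e.order ∧
    ∀ᶠ u in 𝓝[≠] z, e'.toFun (u ^ e.order - z ^ e.order) = e.toFun u

end FunctionElement

/-- The space of all function elements; its connected components are the Riemann surfaces
of the analytic `N × N` matrix functions. -/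
def SurfacePoint (N : ℕ) : Type := Quotient (FunctionElement.setoid N)

namespace SurfacePoint

variable {N : ℕ}

/-- The point defined by a function element. -/
def mk (e : FunctionElement N) : SurfacePoint N := Quotient.mk (FunctionElement.setoid N) e

/-- The affix of a point, i.e. its projection to the complex plane. -/
def affix : SurfacePoint N → ℂ :=
  Quotient.lift FunctionElement.affix fun _ _ h => h.1

/-- The order of a point: the number of sheets that meet there. -/
def order : SurfacePoint N → ℕ :=
  Quotient.lift FunctionElement.order fun _ _ h => h.2.1

/-- The topology of the space of function elements: the basic neighbourhoods of an element consist
of the element and its branches at the values `0 < ‖z‖ < r` of the local parameter. -/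
instance : TopologicalSpace (SurfacePoint N) where
  IsOpen U := ∀ e : FunctionElement N, mk e ∈ U → ∃ r : ℝ, 0 < r ∧
    ∀ (z : ℂ) (e' : FunctionElement N), z ≠ 0 → ‖z‖ < r → e.HasBranchAt z e' → mk e' ∈ U
  isOpen_univ := fun _ _ => ⟨1, one_pos, fun _ _ _ _ _ => Set.mem_univ _⟩
  isOpen_inter := by
    rintro U V hU hV e ⟨heU, heV⟩
    obtain ⟨r, hr, h⟩ := hU e heU
    obtain ⟨s, hs, h'⟩ := hV e heV
    exact ⟨min r s, lt_min hr hs, fun z e' hz hzr hb =>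
      ⟨h z e' hz (hzr.trans_le (min_le_left _ _)) hb,
        h' z e' hz (hzr.trans_le (min_le_right _ _)) hb⟩⟩
  isOpen_sUnion := by
    rintro S hS e ⟨U, hU, he⟩
    obtain ⟨r, hr, h⟩ := hS U hU e he
    exact ⟨r, hr, fun z e' hz hzr hb => ⟨U, hU, h z e' hz hzr hb⟩⟩

end SurfacePoint

/-- The ordinary germ `e` is the germ of the function `F` at the point `e.affix`. -/
def IsGermOf {N : ℕ} (e : FunctionElement N) (F : ℂ → Matrix (Fin N) (Fin N) ℂ) : Prop :=
  e.order = 1 ∧ ∀ᶠ w in 𝓝[≠] (0 : ℂ), e.toFun w = F (e.affix + w)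

/-- The Riemann surface of a function `F` given on a domain `U`, where it is meromorphic: all
function elements in the connected component of the germs of `F` at points of `U`. -/
def riemannSurface {N : ℕ} (F : ℂ → Matrix (Fin N) (Fin N) ℂ) (U : Set ℂ) :
    Set (SurfacePoint N) :=
  {x | ∃ e : FunctionElement N, e.affix ∈ U ∧ IsGermOf e F ∧
    x ∈ connectedComponent (SurfacePoint.mk e)}

/-- The branch points of the Riemann surface of `F`: its points of order at least two. -/
def branchPoints {N : ℕ} (F : ℂ → Matrix (Fin N) (Fin N) ℂ) (U : Set ℂ) :
    Set (SurfacePoint N) :=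
  {x | x ∈ riemannSurface F U ∧ 2 ≤ x.order}

/-- The affixes of the branch points. -/
def branchAffixes {N : ℕ} (F : ℂ → Matrix (Fin N) (Fin N) ℂ) (U : Set ℂ) : Set ℂ :=
  SurfacePoint.affix '' branchPoints F U

/-- The order of an affix: the least common multiple of the orders of all branch points with
this affix. -/
noncomputable def affixOrder {N : ℕ} (F : ℂ → Matrix (Fin N) (Fin N) ℂ) (U : Set ℂ) (τ : ℂ) : ℕ :=
  sInf {n : ℕ | 0 < n ∧ ∀ x ∈ branchPoints F U, x.affix = τ → x.order ∣ n}

/-! ### The factorization problem -/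

/-- The strip `-ε < Im k < ε`. -/
def strip (ε : ℝ) : Set ℂ := {k | -ε < k.im ∧ k.im < ε}

/-- The upper half-plane `Im k > -ε`. -/
def upperDomain (ε : ℝ) : Set ℂ := {k | -ε < k.im}

/-- The lower half-plane `Im k < ε`. -/
def lowerDomain (ε : ℝ) : Set ℂ := {k | k.im < ε}

/-- Every entry of `G` satisfies on `U` (outside a set of isolated points, such as poles) a
polynomial equation `P (k, G i j k) = 0` with a nonzero `P ∈ ℂ[k][y]`. -/
def IsAlgebraicMatrix {N : ℕ} (G : ℂ → Matrix (Fin N) (Fin N) ℂ) (U : Set ℂ) : Prop :=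
  ∀ i j, ∃ P : Polynomial (Polynomial ℂ), P ≠ 0 ∧
    ∀ᶠ k in codiscreteWithin U, P.evalEval k (G k i j) = 0

/-- All entries of `Q` grow in `U` no faster than some power of `‖k‖` as `k → ∞`. -/
def HasAlgebraicGrowth {N : ℕ} (Q : ℂ → Matrix (Fin N) (Fin N) ℂ) (U : Set ℂ) : Prop :=
  ∃ l : ℝ, ∀ i j, (fun k => Q k i j) =O[Bornology.cobounded ℂ ⊓ 𝓟 U] fun k => ‖k‖ ^ l

/-- `Qp`, `Qm` solve the factorization problem for `G`: they are analytic up to isolated poles and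
of algebraic growth in the respective half-planes, and `G = Qp * Qm` in the strip as an identity
of meromorphic functions, that is, outside a set of isolated points. -/
structure IsFactorization {N : ℕ} (ε : ℝ) (G Qp Qm : ℂ → Matrix (Fin N) (Fin N) ℂ) : Prop where
  meromorphic_plus : ∀ k ∈ upperDomain ε, MatMeromorphicAt Qp k
  meromorphic_minus : ∀ k ∈ lowerDomain ε, MatMeromorphicAt Qm k
  growth_plus : HasAlgebraicGrowth Qp (upperDomain ε)
  growth_minus : HasAlgebraicGrowth Qm (lowerDomain ε)
  factorization : ∀ᶠ k in codiscreteWithin (strip ε), G k = Qp k * Qm k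

/-- The function `Q`, given on the domain `U`, continues onto a Riemann surface whose only
singularities (apart from poles) are branch points with affixes `τ ∈ T` and orders dividing `n τ`. -/
structure ContinuesWithBranching {N : ℕ} (Q : ℂ → Matrix (Fin N) (Fin N) ℂ) (U : Set ℂ)
    (T : Set ℂ) (n : ℂ → ℕ) : Prop where
  /-- The Riemann surface is connected (and not empty). -/
  connected : IsConnected (riemannSurface Q U)
  /-- It contains the germs of `Q` at all points of `U`. -/
  extends_function : ∀ k ∈ U, ∃ e : FunctionElement N, e.affix = k ∧ IsGermOf e Q ∧
    SurfacePoint.mk e ∈ riemannSurface Q U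
  /-- `Q` continues from every point of the surface along every path which avoids `T`, except
  perhaps at its end points; a path may end in `T`, where the continuation ends in a point of
  finite order of the surface. -/
  continuation : ∀ x ∈ riemannSurface Q U, ∀ γ : C(unitInterval, ℂ), γ 0 = x.affix →
    (∀ t : unitInterval, 0 < t → t < 1 → γ t ∉ T) →
    ∃ Γ : C(unitInterval, SurfacePoint N), Γ 0 = x ∧
      ∀ t, Γ t ∈ riemannSurface Q U ∧ (Γ t).affix = γ t
  /-- The affix of every branch point belongs to `T`. -/
  branch_affix : ∀ x ∈ branchPoints Q U, x.affix ∈ T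
  /-- The order of every branch point divides the number attached to its affix. -/
  branch_order : ∀ x ∈ branchPoints Q U, 0 < n x.affix ∧ x.order ∣ n x.affix

/-! The two half-planes cover the plane, and since the determinant of `G` is not identically zero,
each factor is recovered in the strip from the other: `Qp = G * Qm⁻¹` and `Qm = Qp⁻¹ * G`. To
continue `Qp` downwards is therefore to continue `G` and multiply by the inverse of `Qm`, which is
single-valued below. Returning to the upper half-plane on another sheet of `G` and going on in this
way, one meets only products of branches of `G`, of `Qp`, `Qm` and of inverses of these. Such
products can branch only where `G` does.

As these products grow without bound along a path, the orders and radii of convergence must be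
controlled for all of them at once. The proof thus works with classes of germs. A class is locally
uniformized with exponents `M` if near each `k₀` every germ of the class is a branch of a function
meromorphic in a disc `‖z‖ < r`, where `k = k₀ + z ^ M k₀`, with all branches again in the class and
with `r` independent of the germ. The points of the surface with branches in such a class form a
clopen set (`isClopen_pointsOver`), their orders divide `M k₀` (`order_dvd_of_mem_pointsOver`), and
paths lift to it by subdivision (`exists_lift_of_mem_pointsOver`). By
`continuesWithBranching_of_isLocallyUniformized` it remains to find a class that contains the germs
of `Qp` and `Qm` and has the exponents `affixOrder`.

For `G` itself, Puiseux's theorem (`hasPuiseuxExpansions`) yields one exponent valid at every `k₀`,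
and `isLocallyUniformized_isSurfaceGerm` replaces it by `affixOrder`, which is `1` off the branch
affixes. The required class is generated by the germs of `G` on all sheets together with `Qp` and
`Qm`. Near a point of one half-plane the corresponding factor is meromorphic without any root, the
other is expressed through it and `G`, and products and inverses do not shrink the disc
(`isLocallyUniformized_generatedGerm`). -/

/-! ### Punctured neighbourhoods under power maps, and meromorphic matrix functions -/

/-- One inclusion is the isolation of preimages, the other the open mapping theorem. It lets
statements about germs be transported both ways through `k = c + u ^ q`. -/
theorem map_nhdsNE_eq_of_analyticAt {f : ℂ → ℂ} {z : ℂ} (hf : AnalyticAt ℂ f z)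
    (hc : ¬ EventuallyConst f (𝓝 z)) : map f (𝓝[≠] z) = 𝓝[≠] (f z) := by
  refine le_antisymm (hf.map_nhdsNE hc) fun A hA => ?_
  have h1 : 𝓝 (f z) ≤ map f (𝓝 z) := by
    refine hf.eventually_constant_or_nhds_le_map_nhds.resolve_left fun h => hc ?_
    exact eventuallyConst_iff_exists_eventuallyEq.2 ⟨f z, h⟩
  have h2 : insert z (f ⁻¹' A) ∈ 𝓝 z := insert_mem_nhds_iff.2 hA
  have h3 : f '' insert z (f ⁻¹' A) ∈ 𝓝 (f z) := h1 (image_mem_map h2)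
  filter_upwards [mem_nhdsWithin_of_mem_nhds h3, self_mem_nhdsWithin] with w hw hne
  obtain ⟨u, hu, rfl⟩ := hw
  rcases hu with rfl | hu
  · exact absurd rfl hne
  · exact hu

theorem map_nhdsNE_pow {q : ℕ} (hq : 0 < q) (c z : ℂ) :
    map (fun u => c + u ^ q) (𝓝[≠] z) = 𝓝[≠] (c + z ^ q) := by
  refine map_nhdsNE_eq_of_analyticAt (f := fun u => c + u ^ q) (by fun_prop) fun h => ?_
  obtain ⟨a, ha⟩ := eventuallyConst_iff_exists_eventuallyEq.1 h
  let p : Polynomial ℂ := Polynomial.X ^ q - Polynomial.C (a - c)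
  have hp : p ≠ 0 := Polynomial.X_pow_sub_C_ne_zero hq _
  have hfin : {u | p.IsRoot u}.Finite := p.finite_setOfPred_isRoot hp
  have : {u | p.IsRoot u} ∈ 𝓝 z := by
    filter_upwards [ha] with u hu
    change p.eval u = 0
    simp only [p, Polynomial.eval_sub, Polynomial.eval_pow, Polynomial.eval_X, Polynomial.eval_C]
    linear_combination hu
  exact infinite_of_mem_nhds z this hfin

theorem eventually_nhdsNE_pow_iff {q : ℕ} (hq : 0 < q) {c z : ℂ} {p : ℂ → Prop} :
    (∀ᶠ u in 𝓝[≠] z, p (c + u ^ q)) ↔ ∀ᶠ w in 𝓝[≠] (c + z ^ q), p w := by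
  rw [← map_nhdsNE_pow hq c z, eventually_map]

theorem eventually_nhdsNE_pow_iff' {q : ℕ} (hq : 0 < q) {z : ℂ} {p : ℂ → Prop} :
    (∀ᶠ u in 𝓝[≠] z, p (u ^ q)) ↔ ∀ᶠ w in 𝓝[≠] (z ^ q), p w := by
  simpa using eventually_nhdsNE_pow_iff hq (c := 0) (z := z) (p := p)

theorem eventually_nhdsNE_zero_pow_iff {q : ℕ} (hq : 0 < q) {p : ℂ → Prop} :
    (∀ᶠ u in 𝓝[≠] (0 : ℂ), p (u ^ q)) ↔ ∀ᶠ w in 𝓝[≠] (0 : ℂ), p w := by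
  rw [eventually_nhdsNE_pow_iff' hq, zero_pow hq.ne']

theorem eventually_nhdsNE_add_iff {c z : ℂ} {p : ℂ → Prop} :
    (∀ᶠ u in 𝓝[≠] z, p (c + u)) ↔ ∀ᶠ w in 𝓝[≠] (c + z), p w := by
  simpa using eventually_nhdsNE_pow_iff one_pos (c := c) (z := z) (p := p)

theorem eventually_nhdsNE_mul_iff {c : ℂ} (hc : c ≠ 0) {z : ℂ} {p : ℂ → Prop} :
    (∀ᶠ u in 𝓝[≠] z, p (c * u)) ↔ ∀ᶠ w in 𝓝[≠] (c * z), p w := by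
  rw [← map_nhdsNE_eq_of_analyticAt (f := fun u => c * u) (by fun_prop), eventually_map]
  intro h
  obtain ⟨a, ha⟩ := eventuallyConst_iff_exists_eventuallyEq.1 h
  have : {u : ℂ | u = a / c} ∈ 𝓝 z := by
    filter_upwards [ha] with u hu
    rw [eq_div_iff hc, mul_comm]; exact hu
  exact infinite_of_mem_nhds z this (Set.finite_singleton _)

theorem exists_pow_eq {M : ℕ} (hM : 0 < M) (w : ℂ) : ∃ z : ℂ, z ^ M = w :=
  IsAlgClosed.exists_pow_nat_eq w hM

/-- Inverse function theorem: the derivative of `c + u ^ M` does not vanish at `z ≠ 0`. -/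
theorem exists_local_root {z : ℂ} (hz : z ≠ 0) {M : ℕ} (hM : 0 < M) (c : ℂ) :
    ∃ r : ℂ → ℂ, AnalyticAt ℂ r (c + z ^ M) ∧ r (c + z ^ M) = z ∧
      (∀ᶠ u in 𝓝 z, r (c + u ^ M) = u) ∧ ∀ᶠ w in 𝓝 (c + z ^ M), c + r w ^ M = w := by
  have hg : AnalyticAt ℂ (fun u : ℂ => c + u ^ M) z := by fun_prop
  have hd : deriv (fun u : ℂ => c + u ^ M) z ≠ 0 := by
    simp [hz, hM.ne']
  have hr := (hg.hasStrictDerivAt.hasStrictFDerivAt_equiv hd).eventually_left_inverse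
  exact ⟨hg.hasStrictDerivAt.localInverse _ _ _ hd, hg.analyticAt_localInverse hd, hr.self_of_nhds,
    hr, (hg.hasStrictDerivAt.hasStrictFDerivAt_equiv hd).eventually_right_inverse⟩

/-- The identity theorem for meromorphic functions: on a preconnected set the order is infinite
everywhere or nowhere. -/
theorem eventually_eq_zero_of_preconnected {f : ℂ → ℂ} {U : Set ℂ} (hU : IsPreconnected U)
    (hf : ∀ z ∈ U, MeromorphicAt f z) {x y : ℂ} (hx : x ∈ U) (hy : y ∈ U)
    (h : ∀ᶠ w in 𝓝[≠] x, f w = 0) : ∀ᶠ w in 𝓝[≠] y, f w = 0 := by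
  by_contra hne
  rw [← meromorphicOrderAt_eq_top_iff] at hne
  exact MeromorphicOn.meromorphicOrderAt_ne_top_of_isPreconnected hf hU hy hx hne
    (meromorphicOrderAt_eq_top_iff.2 h)

namespace MatMeromorphicAt

variable {N : ℕ} {F H : ℂ → Matrix (Fin N) (Fin N) ℂ} {k : ℂ}

theorem congr (hF : MatMeromorphicAt F k) (h : ∀ᶠ w in 𝓝[≠] k, F w = H w) :
    MatMeromorphicAt H k := fun i j =>
  (hF i j).congr (h.mono fun w hw => by simp only [hw])

theorem comp_analyticAt {g : ℂ → ℂ} (hF : MatMeromorphicAt F (g k)) (hg : AnalyticAt ℂ g k) :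
    MatMeromorphicAt (fun z => F (g z)) k := fun i j => (hF i j).comp_analyticAt hg

theorem mul (hF : MatMeromorphicAt F k) (hH : MatMeromorphicAt H k) :
    MatMeromorphicAt (fun z => F z * H z) k := fun i j => by
  simp only [Matrix.mul_apply]
  exact MeromorphicAt.fun_sum fun l _ => (hF i l).mul (hH l j)

theorem det (hF : MatMeromorphicAt F k) : MeromorphicAt (fun z => (F z).det) k := by
  simp only [Matrix.det_apply']
  exact MeromorphicAt.fun_sum fun σ _ =>
    (MeromorphicAt.const _ _).mul (MeromorphicAt.fun_prod fun i _ => hF _ _)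

theorem inv (hF : MatMeromorphicAt F k) : MatMeromorphicAt (fun z => (F z)⁻¹) k := fun i j => by
  simp only [Matrix.inv_def, Matrix.smul_apply, Ring.inverse_eq_inv', smul_eq_mul,
    Matrix.adjugate_apply]
  refine hF.det.inv.mul (det (F := fun z => (F z).updateRow j (Pi.single i 1)) fun a b => ?_)
  by_cases h : a = j
  · subst h; simp [MeromorphicAt.const]
  · simpa [Matrix.updateRow_ne h] using hF a b

theorem eventually (hF : MatMeromorphicAt F k) : ∀ᶠ w in 𝓝[≠] k, MatMeromorphicAt F w := by
  simp only [MatMeromorphicAt, eventually_all]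
  exact fun i j => (hF i j).eventually_analyticAt.mono fun _ h => h.meromorphicAt

theorem eventually_eq_of_preconnected {U : Set ℂ} (hU : IsPreconnected U)
    (hF : ∀ z ∈ U, MatMeromorphicAt F z) (hH : ∀ z ∈ U, MatMeromorphicAt H z) {x y : ℂ}
    (hx : x ∈ U) (hy : y ∈ U) (h : ∀ᶠ w in 𝓝[≠] x, F w = H w) :
    ∀ᶠ w in 𝓝[≠] y, F w = H w := by
  have : ∀ i j, ∀ᶠ w in 𝓝[≠] y, F w i j = H w i j := fun i j =>
    (eventually_eq_zero_of_preconnected hU (f := fun w => F w i j - H w i j)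
      (fun z hz => (hF z hz i j).sub (hH z hz i j)) hx hy
      (h.mono fun w hw => by simp [hw])).mono fun w hw => sub_eq_zero.1 hw
  filter_upwards [eventually_all.2 fun i => eventually_all.2 (this i)] with w hw
  exact Matrix.ext hw

/-- A matrix function of the local parameter `u` is, away from `u = 0`, locally a function of
`c + u ^ M`. -/
theorem exists_comp_pow_eq {z : ℂ} (hF : MatMeromorphicAt F z) {M : ℕ} (hM : 0 < M) (hz : z ≠ 0)
    (c : ℂ) : ∃ H : ℂ → Matrix (Fin N) (Fin N) ℂ, MatMeromorphicAt H (c + z ^ M) ∧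
      ∀ᶠ u in 𝓝 z, H (c + u ^ M) = F u := by
  obtain ⟨r, hr, hrz, hru, -⟩ := exists_local_root hz hM c
  refine ⟨fun w => F (r w), comp_analyticAt ?_ hr, hru.mono fun u hu => by simp only [hu]⟩
  rwa [hrz]

end MatMeromorphicAt

/-! ### Removable singularities -/

theorem meromorphicAt_of_bounded {f : ℂ → ℂ} {c : ℂ}
    (hd : ∀ᶠ z in 𝓝[≠] c, DifferentiableAt ℂ f z) {C : ℝ} (hb : ∀ᶠ z in 𝓝[≠] c, ‖f z‖ ≤ C) :
    MeromorphicAt f c := by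
  obtain ⟨S, hS1, hS2, hS3⟩ := eventually_nhds_iff.mp (eventually_nhdsWithin_iff.mp (hd.and hb))
  have h1 : DifferentiableOn ℂ f (S \ {c}) :=
    fun x hx => (hS1 x hx.1 hx.2).1.differentiableWithinAt
  have h2 : BddAbove (norm ∘ f '' (S \ {c})) := by
    refine ⟨C, ?_⟩
    rintro _ ⟨q, hq, rfl⟩
    exact (hS1 q hq.1 hq.2).2
  have := Complex.differentiableOn_update_limUnder_of_bddAbove (hS2.mem_nhds hS3) h1 h2
  refine (this.analyticAt (hS2.mem_nhds hS3)).meromorphicAt.congr ?_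
  filter_upwards [self_mem_nhdsWithin] with z hz
  exact Function.update_of_ne hz _ _

theorem meromorphicAt_of_mul_bounded {f p : ℂ → ℂ} {c : ℂ} (hp : AnalyticAt ℂ p c)
    (hp0 : ∀ᶠ z in 𝓝[≠] c, p z ≠ 0)
    (hd : ∀ᶠ z in 𝓝[≠] c, DifferentiableAt ℂ f z) {C : ℝ}
    (hb : ∀ᶠ z in 𝓝[≠] c, ‖p z * f z‖ ≤ C) : MeromorphicAt f c := by
  have hpd : ∀ᶠ z in 𝓝[≠] c, DifferentiableAt ℂ p z :=
    (hp.eventually_analyticAt.mono fun z hz => hz.differentiableAt).filter_mono nhdsWithin_le_nhds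
  have := meromorphicAt_of_bounded (f := fun z => p z * f z)
    (by filter_upwards [hd, hpd] with z h1 h2 using h2.mul h1) hb
  refine (hp.meromorphicAt.inv.mul this).congr ?_
  filter_upwards [hp0] with z hz
  simp [hz]

/-! ### Simple roots of a polynomial in `y` with coefficients in `ℂ[k]` -/

open Polynomial in
theorem evalEval_eq_eval_map (P : ℂ[X][X]) (k y : ℂ) :
    P.evalEval k y = (P.map (evalRingHom k)).eval y := by
  rw [eval_map, eval₂_evalRingHom]

open Polynomial in
theorem evalEval_eq_sum (P : ℂ[X][X]) (k y : ℂ) :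
    P.evalEval k y = ∑ i ∈ Finset.range (P.natDegree + 1), (P.coeff i).eval k * y ^ i := by
  rw [evalEval, eval_eq_sum_range (p := P), eval_finsetSum]
  simp

open Polynomial in
theorem contDiff_evalEval (P : ℂ[X][X]) : ContDiff ℂ 1 fun p : ℂ × ℂ => P.evalEval p.1 p.2 := by
  simp only [evalEval_eq_sum]
  refine ContDiff.sum fun i _ => ContDiff.mul ?_ (contDiff_snd.pow i)
  exact ((P.coeff i).differentiable.contDiff (n := 1)).comp contDiff_fst

open Polynomial in
theorem hasDerivAt_evalEval (P : ℂ[X][X]) (k y : ℂ) :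
    HasDerivAt (fun y => P.evalEval k y) (P.derivative.evalEval k y) y := by
  simp only [evalEval_eq_eval_map, ← derivative_map]
  exact Polynomial.hasDerivAt _ _

open Polynomial in
/-- Near a simple root, the pair of `k` and the value of the polynomial are local coordinates. -/
theorem exists_straightening (P : ℂ[X][X]) {k y : ℂ} (h : P.derivative.evalEval k y ≠ 0) :
    ∃ Ψ : OpenPartialHomeomorph (ℂ × ℂ) (ℂ × ℂ), (k, y) ∈ Ψ.source ∧
      (∀ p, Ψ p = (p.1, P.evalEval p.1 p.2)) ∧
      DifferentiableAt ℂ Ψ.symm (k, P.evalEval k y) := by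
  have h1 : HasStrictFDerivAt (fun p : ℂ × ℂ => P.evalEval p.1 p.2)
      (fderiv ℂ (fun p : ℂ × ℂ => P.evalEval p.1 p.2) (k, y)) (k, y) :=
    (contDiff_evalEval P).contDiffAt.hasStrictFDerivAt one_ne_zero
  set f' := fderiv ℂ (fun p : ℂ × ℂ => P.evalEval p.1 p.2) (k, y) with hf'
  have h2 : f' (0, 1) = P.derivative.evalEval k y := by
    have h3 : HasDerivAt (fun t : ℂ => (k, t)) ((0 : ℂ), (1 : ℂ)) y :=
      (hasDerivAt_const y k).prodMk (hasDerivAt_id y)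
    exact (h1.hasFDerivAt.comp_hasDerivAt y h3).unique (hasDerivAt_evalEval P k y)
  set c := P.derivative.evalEval k y with hc
  have h4 : ∀ a b : ℂ, f' (a, b) = f' (a, 0) + b * c := fun a b => by
    have : ((a, b) : ℂ × ℂ) = (a, 0) + b • (0, 1) := by simp
    rw [this, map_add, map_smul, h2, smul_eq_mul]
  let L : (ℂ × ℂ) →L[ℂ] ℂ × ℂ := (ContinuousLinearMap.fst ℂ ℂ ℂ).prod f'
  let L' : (ℂ × ℂ) →L[ℂ] ℂ × ℂ := (ContinuousLinearMap.fst ℂ ℂ ℂ).prod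
    (c⁻¹ • (ContinuousLinearMap.snd ℂ ℂ ℂ - f'.comp (ContinuousLinearMap.inl ℂ ℂ ℂ ∘L
      ContinuousLinearMap.fst ℂ ℂ ℂ)))
  let e : (ℂ × ℂ) ≃L[ℂ] ℂ × ℂ := ContinuousLinearEquiv.equivOfInverse L L'
    (by
      rintro ⟨a, b⟩
      simp only [L, L', ContinuousLinearMap.prod_apply, ContinuousLinearMap.coe_fst',
        smul_apply, sub_apply,
        ContinuousLinearMap.coe_snd', ContinuousLinearMap.comp_apply,
        ContinuousLinearMap.inl_apply, smul_eq_mul, Prod.mk.injEq, true_and]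
      rw [h4 a b]; field_simp; ring)
    (by
      rintro ⟨a, b⟩
      simp only [L, L', ContinuousLinearMap.prod_apply, ContinuousLinearMap.coe_fst',
        smul_apply, sub_apply,
        ContinuousLinearMap.coe_snd', ContinuousLinearMap.comp_apply,
        ContinuousLinearMap.inl_apply, smul_eq_mul, Prod.mk.injEq, true_and]
      rw [h4 a (c⁻¹ * _)]; field_simp; ring)
  have h5 : HasStrictFDerivAt (fun p : ℂ × ℂ => (p.1, P.evalEval p.1 p.2))
      (e : (ℂ × ℂ) →L[ℂ] ℂ × ℂ) (k, y) := hasStrictFDerivAt_fst.prodMk h1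
  refine ⟨h5.toOpenPartialHomeomorph _, h5.mem_toOpenPartialHomeomorph_source, fun p => rfl, ?_⟩
  exact h5.to_localInverse.hasFDerivAt.differentiableAt

open Polynomial in
-- The straightening map is injective and sends both `(φ u, Y₁ u)` and `(φ u, Y₂ u)` to `(φ u, 0)`.
theorem eventually_eq_of_simple_root (P : ℂ[X][X]) {φ Y₁ Y₂ : ℂ → ℂ} {w : ℂ}
    (hφ : ContinuousAt φ w) (h₁ : ContinuousAt Y₁ w) (h₂ : ContinuousAt Y₂ w)
    (hw : Y₁ w = Y₂ w) (hs : P.derivative.evalEval (φ w) (Y₁ w) ≠ 0)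
    (r₁ : ∀ᶠ u in 𝓝 w, P.evalEval (φ u) (Y₁ u) = 0)
    (r₂ : ∀ᶠ u in 𝓝 w, P.evalEval (φ u) (Y₂ u) = 0) : ∀ᶠ u in 𝓝 w, Y₁ u = Y₂ u := by
  obtain ⟨Ψ, hΨ, hf, -⟩ := exists_straightening P hs
  have e₁ : ∀ᶠ u in 𝓝 w, (φ u, Y₁ u) ∈ Ψ.source :=
    (hφ.prodMk h₁).eventually_mem (Ψ.open_source.mem_nhds hΨ)
  have e₂ : ∀ᶠ u in 𝓝 w, (φ u, Y₂ u) ∈ Ψ.source :=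
    (hφ.prodMk h₂).eventually_mem (Ψ.open_source.mem_nhds (by rwa [← hw]))
  filter_upwards [e₁, e₂, r₁, r₂] with u a b c d
  have := Ψ.injOn a b (by rw [hf, hf, c, d])
  exact (Prod.mk.inj this).2

open Polynomial in
-- Near `w` the root is the second component of the inverse straightening map at `(φ u, 0)`.
theorem differentiableAt_of_simple_root (P : ℂ[X][X]) {φ Y : ℂ → ℂ} {w : ℂ}
    (hφ : DifferentiableAt ℂ φ w) (hY : ContinuousAt Y w)
    (hs : P.derivative.evalEval (φ w) (Y w) ≠ 0)
    (r : ∀ᶠ u in 𝓝 w, P.evalEval (φ u) (Y u) = 0) : DifferentiableAt ℂ Y w := by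
  obtain ⟨Ψ, hΨ, hf, hd⟩ := exists_straightening P hs
  have e : ∀ᶠ u in 𝓝 w, (φ u, Y u) ∈ Ψ.source :=
    (hφ.continuousAt.prodMk hY).eventually_mem (Ψ.open_source.mem_nhds hΨ)
  rw [r.self_of_nhds] at hd
  have hd' : DifferentiableAt ℂ (fun u => (Ψ.symm (φ u, 0)).2) w :=
    (DifferentiableAt.comp (f := fun u => (φ u, (0 : ℂ))) w hd
      (hφ.prodMk (differentiableAt_const 0))).snd
  refine hd'.congr_of_eventuallyEq ?_
  filter_upwards [e, r] with u a b
  rw [← b, ← hf (φ u, Y u), Ψ.left_inv a]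

open Polynomial in
-- Cauchy's bound for roots, multiplied by the leading coefficient. It makes the covering of roots
-- proper and allows only poles where the leading coefficient vanishes.
theorem norm_root_le (P : ℂ[X][X]) {k y : ℂ} (ha : P.leadingCoeff.eval k ≠ 0)
    (h : P.evalEval k y = 0) : ‖P.leadingCoeff.eval k * y‖ ≤
      ∑ i ∈ Finset.range (P.natDegree + 1), ‖(P.coeff i).eval k‖ := by
  set p := P.map (evalRingHom k) with hp
  have hdeg : p.natDegree = P.natDegree := natDegree_map_of_leadingCoeff_ne_zero _ ha
  have hlc : p.leadingCoeff = P.leadingCoeff.eval k := by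
    rw [leadingCoeff, hdeg, hp, coeff_map]; rfl
  have hp0 : p ≠ 0 := fun h0 => ha (by rw [← hlc, h0, leadingCoeff_zero])
  have hr : p.IsRoot y := by rw [IsRoot, ← evalEval_eq_eval_map, h]
  have hb := hr.norm_lt_cauchyBound hp0
  have hb' : ‖y‖ ≤ (p.cauchyBound : ℝ) := by exact_mod_cast hb.le
  have hpos : 0 < ‖p.leadingCoeff‖ := norm_pos_iff.2 (by rwa [hlc])
  have hsup : ((Finset.range p.natDegree).sup (fun i => ‖p.coeff i‖₊) : NNReal) ≤
      ∑ i ∈ Finset.range p.natDegree, ‖p.coeff i‖₊ := by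
    refine Finset.sup_le fun i hi => ?_
    exact Finset.single_le_sum (f := fun i => ‖p.coeff i‖₊) (fun _ _ => zero_le) hi
  have hsup' : (((Finset.range p.natDegree).sup (fun i => ‖p.coeff i‖₊) : NNReal) : ℝ) ≤
      ∑ i ∈ Finset.range p.natDegree, ‖p.coeff i‖ := by
    have := NNReal.coe_le_coe.2 hsup
    rwa [NNReal.coe_sum] at this
  rw [norm_mul, ← hlc]
  have hco : ∀ i, (P.coeff i).eval k = p.coeff i := fun i => by rw [hp, coeff_map]; rfl
  simp only [hco]
  rw [Finset.sum_range_succ, ← hdeg]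
  calc ‖p.leadingCoeff‖ * ‖y‖ ≤ ‖p.leadingCoeff‖ * (p.cauchyBound : ℝ) := by gcongr
    _ = (((Finset.range p.natDegree).sup (fun i => ‖p.coeff i‖₊) : NNReal) : ℝ)
        + ‖p.leadingCoeff‖ := by
      rw [cauchyBound]; push_cast; field_simp
    _ ≤ _ := by gcongr; rfl

open Polynomial in
/-- The finite covering given by the simple roots of a polynomial. -/
theorem isCoveringMap_roots (P : ℂ[X][X]) (s : Set ℂ)
    (hlc : ∀ k ∈ s, P.leadingCoeff.eval k ≠ 0)
    (hs : ∀ k ∈ s, ∀ y, P.evalEval k y = 0 → P.derivative.evalEval k y ≠ 0) :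
    IsCoveringMap fun p : {p : ℂ × ℂ // p.1 ∈ s ∧ P.evalEval p.1 p.2 = 0} =>
      (⟨p.1.1, p.2.1⟩ : s) := by
  set f := fun p : {p : ℂ × ℂ // p.1 ∈ s ∧ P.evalEval p.1 p.2 = 0} => (⟨p.1.1, p.2.1⟩ : s)
    with hf
  have hcont : Continuous fun p : ℂ × ℂ => P.evalEval p.1 p.2 := (contDiff_evalEval P).continuous
  have hfc : Continuous f := by fun_prop
  have hlocal : IsLocalHomeomorph f := by
    rw [isLocalHomeomorph_iff_isOpenEmbedding_restrict]
    rintro ⟨⟨k, y⟩, hk, hy⟩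
    obtain ⟨Ψ, hΨ, hΨf, -⟩ := exists_straightening P (hs k hk y hy)
    refine ⟨Subtype.val ⁻¹' Ψ.source,
      (Ψ.open_source.preimage continuous_subtype_val).mem_nhds hΨ, ?_⟩
    refine .of_continuous_injective_isOpenMap (hfc.comp continuous_subtype_val) ?_ ?_
    · rintro ⟨⟨⟨a, b⟩, ha, hb⟩, h⟩ ⟨⟨⟨a', b'⟩, ha', hb'⟩, h'⟩ heq
      have e : a = a' := congrArg Subtype.val heq
      subst e
      have := Ψ.injOn h h' (by rw [hΨf, hΨf]; exact Prod.ext rfl (hb.trans hb'.symm))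
      simpa using this
    · have ho : IsOpen (Subtype.val ⁻¹' Ψ.source :
          Set {p : ℂ × ℂ // p.1 ∈ s ∧ P.evalEval p.1 p.2 = 0}) :=
        Ψ.open_source.preimage continuous_subtype_val
      intro V hV
      obtain ⟨V₁, hV₁, rfl⟩ := isOpen_induced_iff.1 hV
      obtain ⟨W, hW, rfl⟩ := isOpen_induced_iff.1 hV₁
      have hWo : IsOpen (Ψ '' (Ψ.source ∩ W)) := Ψ.isOpen_image_source_inter hW
      have : IsOpen ((fun k : s => ((k : ℂ), (0 : ℂ))) ⁻¹' (Ψ '' (Ψ.source ∩ W))) :=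
        hWo.preimage (by fun_prop)
      convert this using 1
      ext ⟨a, ha⟩
      constructor
      · rintro ⟨⟨⟨⟨a', b⟩, ha', hb⟩, h⟩, hW', heq⟩
        have e : a' = a := congrArg Subtype.val heq
        subst e
        exact ⟨(a', b), ⟨h, hW'⟩, by rw [hΨf]; exact Prod.ext rfl hb⟩
      · rintro ⟨⟨a', b⟩, ⟨h, hW'⟩, heq⟩
        rw [hΨf] at heq
        obtain ⟨e, hb⟩ := Prod.mk.inj heq
        dsimp only at e hb
        subst e
        exact ⟨⟨⟨(a', b), ha, hb⟩, h⟩, hW', rfl⟩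
  have hclosed : IsClosedMap f := by
    -- Properness: over a compact `K` the roots form a closed set, bounded by Cauchy's bound because
    -- the leading coefficient has no zero on `K`. A closed local homeomorphism with finite fibres
    -- is a covering.
    refine IsProperMap.isClosedMap (isProperMap_iff_isCompact_preimage.2 ⟨hfc, fun K hK => ?_⟩)
    have hK' : IsCompact (Subtype.val '' K) := hK.image continuous_subtype_val
    have hKs : ∀ k ∈ Subtype.val '' K, k ∈ s := by rintro _ ⟨k, -, rfl⟩; exact k.2
    obtain ⟨C, hC⟩ := hK'.exists_bound_of_continuousOn (f := fun k =>
        (∑ i ∈ Finset.range (P.natDegree + 1), ‖(P.coeff i).eval k‖) / ‖P.leadingCoeff.eval k‖) (by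
      refine ContinuousOn.div (by fun_prop) (by fun_prop) fun k hk => ?_
      exact norm_ne_zero_iff.2 (hlc k (hKs k hk)))
    rw [Subtype.isCompact_iff]
    have himage : Subtype.val '' (f ⁻¹' K) =
        {p : ℂ × ℂ | p.1 ∈ Subtype.val '' K} ∩ {p | P.evalEval p.1 p.2 = 0} := by
      ext ⟨a, b⟩
      constructor
      · rintro ⟨⟨p, hp, hp'⟩, h, rfl⟩
        exact ⟨⟨_, h, rfl⟩, hp'⟩
      · rintro ⟨⟨⟨x, hx⟩, hx', heq⟩, hb⟩
        dsimp only at heq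
        subst heq
        exact ⟨⟨(x, b), hx, hb⟩, hx', rfl⟩
    rw [himage]
    refine IsCompact.of_isClosed_subset (hK'.prod (isCompact_closedBall (0 : ℂ) C)) ?_ ?_
    · exact (hK'.isClosed.preimage continuous_fst).inter (isClosed_eq hcont continuous_const)
    · rintro ⟨a, b⟩ ⟨ha, hb⟩
      refine ⟨ha, ?_⟩
      have h1 := norm_root_le P (hlc a (hKs a ha)) hb
      have h2 := (le_abs_self _).trans (hC a ha)
      have h3 : 0 < ‖P.leadingCoeff.eval a‖ := norm_pos_iff.2 (hlc a (hKs a ha))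
      rw [div_le_iff₀ h3] at h2
      rw [norm_mul] at h1
      rw [mem_closedBall_zero_iff]
      exact le_of_mul_le_mul_left (h1.trans (h2.trans_eq (mul_comm _ _))) h3
  have hfin : ∀ x ∈ (Set.univ : Set s), (f ⁻¹' {x}).Finite := by
    rintro ⟨k, hk⟩ -
    have hp : P.map (evalRingHom k) ≠ 0 := fun h => hlc k hk (by
      have := congrArg (fun q => q.coeff P.natDegree) h
      simpa using this)
    have := (P.map (evalRingHom k)).finite_setOfPred_isRoot hp
    refine Set.Finite.of_finite_image (f := fun p => p.1.2) (this.subset ?_) ?_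
    · rintro _ ⟨⟨⟨a, b⟩, ha, hb⟩, hx, rfl⟩
      have e : a = k := congrArg Subtype.val hx
      subst e
      change IsRoot _ _
      rw [IsRoot, ← evalEval_eq_eval_map]; exact hb
    · rintro ⟨⟨a, b⟩, ha, hb⟩ hx ⟨⟨a', b'⟩, ha', hb'⟩ hx' heq
      have e : a = k := congrArg Subtype.val hx
      have e' : a' = k := congrArg Subtype.val hx'
      simp only at heq
      subst e e' heq
      rfl
  exact isCoveringMap_iff_isCoveringMapOn_univ.2
    (hclosed.isCoveringMapOn_of_isLocalHomeomorphOn hfin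
      (by simpa using hlocal.isLocalHomeomorphOn))

open Polynomial in
-- The convex set `H` is simply connected, so `φ` lifts to the covering of roots; the lift is
-- differentiable because the roots are simple.
theorem exists_root_section (P : ℂ[X][X]) {s H : Set ℂ}
    (hlc : ∀ k ∈ s, P.leadingCoeff.eval k ≠ 0)
    (hs : ∀ k ∈ s, ∀ y, P.evalEval k y = 0 → P.derivative.evalEval k y ≠ 0)
    (hH : IsOpen H) (hconv : Convex ℝ H) {φ : ℂ → ℂ} (hφ : Differentiable ℂ φ)
    (hφs : ∀ w ∈ H, φ w ∈ s) {w₁ y₁ : ℂ} (hw₁ : w₁ ∈ H) (hy₁ : P.evalEval (φ w₁) y₁ = 0) :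
    ∃ Y : ℂ → ℂ, DifferentiableOn ℂ Y H ∧ (∀ w ∈ H, P.evalEval (φ w) (Y w) = 0) ∧
      Y w₁ = y₁ := by
  have hcov := isCoveringMap_roots P s hlc hs
  have : LocallyPathConnectedSpace H := hH.locallyPathConnectedSpace
  have : ContractibleSpace H := hconv.contractibleSpace ⟨w₁, hw₁⟩
  let g : C(H, s) := ⟨fun w => ⟨φ w, hφs w w.2⟩,
    (hφ.continuous.comp continuous_subtype_val).subtype_mk _⟩
  obtain ⟨Y, ⟨hY0, hY⟩, -⟩ := hcov.existsUnique_continuousMap_lifts g ⟨w₁, hw₁⟩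
    ⟨(φ w₁, y₁), hφs w₁ hw₁, hy₁⟩ rfl
  have hYφ : ∀ w : H, (Y w).1.1 = φ w := fun w => congrArg Subtype.val (congrFun hY w)
  classical
  let Z : ℂ → ℂ := fun w => if h : w ∈ H then (Y ⟨w, h⟩).1.2 else 0
  have hZ : ∀ w : H, Z w = (Y w).1.2 := fun w => by simp [Z]
  have hZroot : ∀ w ∈ H, P.evalEval (φ w) (Z w) = 0 := fun w hw => by
    rw [hZ ⟨w, hw⟩, ← hYφ ⟨w, hw⟩]; exact (Y ⟨w, hw⟩).2.2
  have hZc : ContinuousOn Z H := by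
    rw [continuousOn_iff_continuous_domRestrict]
    have : H.domRestrict Z = fun w : H => (Y w).1.2 := funext hZ
    rw [this]; fun_prop
  refine ⟨Z, fun w hw => ?_, hZroot, ?_⟩
  · refine (differentiableAt_of_simple_root P (hφ w) (hZc.continuousAt (hH.mem_nhds hw))
      (hs _ (hφs w hw) _ (hZroot w hw)) ?_).differentiableWithinAt
    filter_upwards [hH.mem_nhds hw] with u hu using hZroot u hu
  · rw [hZ ⟨w₁, hw₁⟩, hY0]

open Polynomial in
/-- If the roots are invariant under a translation of the simply connected domain, then every
analytic root is periodic, the period being at most the degree. -/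
theorem exists_period (P : ℂ[X][X]) {s H : Set ℂ}
    (hlc : ∀ k ∈ s, P.leadingCoeff.eval k ≠ 0)
    (hs : ∀ k ∈ s, ∀ y, P.evalEval k y = 0 → P.derivative.evalEval k y ≠ 0)
    (hH : IsOpen H) (hconv : Convex ℝ H) (hne : H.Nonempty) {φ : ℂ → ℂ} (hφ : Differentiable ℂ φ)
    (hφs : ∀ w ∈ H, φ w ∈ s) {c : ℂ} (hHc : ∀ (w : ℂ) (j : ℤ), w ∈ H → w + j * c ∈ H)
    (hφc : ∀ (w : ℂ) (j : ℤ), φ (w + j * c) = φ w) {Y : ℂ → ℂ} (hY : DifferentiableOn ℂ Y H)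
    (hYroot : ∀ w ∈ H, P.evalEval (φ w) (Y w) = 0) (j : ℤ) (w : ℂ) (hw : w ∈ H) :
    Y (w + (j * (P.natDegree.factorial : ℤ) : ℤ) * c) = Y w := by
  obtain ⟨w₀, hw₀⟩ := hne
  have hp : P.map (evalRingHom (φ w₀)) ≠ 0 := fun h => hlc _ (hφs _ hw₀) (by
    have := congrArg (fun q => q.coeff P.natDegree) h
    simpa using this)
  have hroot : ∀ (i : ℤ), ∀ w ∈ H, P.evalEval (φ w) (Y (w + i * c)) = 0 := fun i w hw => by
    rw [← hφc w i]; exact hYroot _ (hHc w i hw)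
  -- Pigeonhole: `natDegree + 1` translates of `Y` take values among at most `natDegree` roots over
  -- `φ w₀`. Two that agree at `w₀` agree on all of `H`.
  obtain ⟨i, hi, i', hi', hne, heq⟩ : ∃ i ∈ Finset.range (P.natDegree + 1),
      ∃ i' ∈ Finset.range (P.natDegree + 1), i ≠ i' ∧
        Y (w₀ + (i : ℤ) * c) = Y (w₀ + (i' : ℤ) * c) := by
    refine Finset.exists_ne_map_eq_of_card_lt_of_maps_to
      (t := (P.map (evalRingHom (φ w₀))).roots.toFinset) ?_ ?_
    · rw [Finset.card_range]
      exact ((Multiset.toFinset_card_le _).trans ((card_roots' _).trans natDegree_map_le)).trans_lt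
        (Nat.lt_succ_self _)
    · intro i _
      simp only [Finset.mem_coe, Multiset.mem_toFinset, mem_roots hp]
      rw [IsRoot, ← evalEval_eq_eval_map]
      exact hroot i w₀ hw₀
  have hdiff : ∀ i : ℤ, DifferentiableOn ℂ (fun w => Y (w + i * c)) H := fun i =>
    hY.comp (by fun_prop) fun w hw => hHc w i hw
  have hloc : ∀ᶠ w in 𝓝 w₀, Y (w + (i : ℤ) * c) = Y (w + (i' : ℤ) * c) := by
    have hm := hH.mem_nhds hw₀
    refine eventually_eq_of_simple_root P (φ := φ) (Y₁ := fun w => Y (w + (i : ℤ) * c))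
      (Y₂ := fun w => Y (w + (i' : ℤ) * c)) hφ.continuous.continuousAt
      ((hdiff i).differentiableAt hm).continuousAt ((hdiff i').differentiableAt hm).continuousAt
      heq (hs _ (hφs _ hw₀) _ (hroot i w₀ hw₀)) ?_ ?_
    · filter_upwards [hm] with u hu using hroot i u hu
    · filter_upwards [hm] with u hu using hroot i' u hu
  have hall := ((hdiff i).analyticOnNhd hH).eqOn_of_preconnected_of_eventuallyEq
    ((hdiff i').analyticOnNhd hH) hconv.isPreconnected hw₀ hloc
  have hper : ∀ w ∈ H, Y (w + ((i' : ℤ) - (i : ℤ) : ℤ) * c) = Y w := fun w hw => by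
    have := hall (hHc w (-i) hw)
    simp only at this
    push_cast at this ⊢
    rw [show w + -(i : ℂ) * c + i * c = w by ring] at this
    rw [this]; ring_nf
  have hnat : ∀ (d : ℤ), (∀ w ∈ H, Y (w + d * c) = Y w) → ∀ m : ℕ, ∀ w ∈ H,
      Y (w + (m * d : ℤ) * c) = Y w := fun d hd m => by
    induction m with
    | zero => intro w _; simp
    | succ m ih =>
      intro w hw
      refine Eq.trans ?_ ((hd _ (hHc w (m * d) hw)).trans (ih w hw))
      push_cast; ring_nf
  have hint : ∀ (d : ℤ), (∀ w ∈ H, Y (w + d * c) = Y w) → ∀ m : ℤ, ∀ w ∈ H,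
      Y (w + (m * d : ℤ) * c) = Y w := fun d hd m => by
    obtain ⟨m, rfl | rfl⟩ := m.eq_nat_or_neg
    · exact hnat d hd m
    · intro w hw
      refine (hnat d hd m _ (hHc w _ hw)).symm.trans ?_
      push_cast; ring_nf
  set d : ℤ := (i' : ℤ) - i with hd
  have hd0 : d ≠ 0 := by omega
  -- The period `d` depends on `Y`, but `0 < |d| ≤ natDegree`, so the factorial is a common period
  -- for all roots.
  have hdvd : d ∣ (P.natDegree.factorial : ℤ) := by
    rw [← Int.natAbs_dvd, Int.natCast_dvd_natCast]
    refine Nat.dvd_factorial (Int.natAbs_pos.2 hd0) ?_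
    simp only [Finset.mem_range] at hi hi'
    omega
  obtain ⟨m, hm⟩ := hdvd
  rw [hm, show j * (d * m) = (j * m) * d by ring]
  exact hint d hper (j * m) w hw

/-! ### Puiseux's theorem -/

/-- Near every point of the plane, the meromorphic solutions of `P (k, y) = 0` are given by
Puiseux series in `(k - k₀) ^ (1 / M)`, in a punctured disc not depending on the solution. -/
def HasPuiseuxExpansions (P : Polynomial (Polynomial ℂ)) : Prop :=
  ∃ M : ℕ, 0 < M ∧ ∀ k₀ : ℂ, ∃ r : ℝ, 0 < r ∧ ∀ z₁ : ℂ, z₁ ≠ 0 → ‖z₁‖ < r → ∀ y : ℂ → ℂ,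
    MeromorphicAt y (k₀ + z₁ ^ M) →
    (∀ᶠ w in 𝓝[≠] (k₀ + z₁ ^ M), P.evalEval w (y w) = 0) →
    ∃ h : ℂ → ℂ, (∀ z, ‖z‖ < r → MeromorphicAt h z) ∧
      ∀ᶠ u in 𝓝[≠] z₁, y (k₀ + u ^ M) = h u

open Polynomial in
/-- A meromorphic root is analytic where the leading coefficient does not vanish. -/
theorem exists_analytic_root (P : ℂ[X][X]) {k : ℂ} (hlc : P.leadingCoeff.eval k ≠ 0) {y : ℂ → ℂ}
    (hy : MeromorphicAt y k) (hroot : ∀ᶠ w in 𝓝[≠] k, P.evalEval w (y w) = 0) :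
    ∃ g : ℂ → ℂ, AnalyticAt ℂ g k ∧ (∀ᶠ w in 𝓝[≠] k, y w = g w) ∧
      ∀ᶠ w in 𝓝 k, P.evalEval w (g w) = 0 := by
  -- A pole would violate Cauchy's bound, which stays finite near `k`.
  have hord : 0 ≤ meromorphicOrderAt y k := by
    by_contra hneg
    have htop := tendsto_norm_cobounded_atTop.comp
      (tendsto_cobounded_of_meromorphicOrderAt_neg (not_le.1 hneg))
    have hc : ContinuousAt (fun w => (∑ i ∈ Finset.range (P.natDegree + 1),
        ‖(P.coeff i).eval w‖) / ‖P.leadingCoeff.eval w‖) k :=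
      ContinuousAt.div (by fun_prop) (by fun_prop) (norm_ne_zero_iff.2 hlc)
    have hb := hc.eventually (eventually_le_nhds (lt_add_one _))
    have hlc' : ∀ᶠ w in 𝓝 k, P.leadingCoeff.eval w ≠ 0 :=
      P.leadingCoeff.continuous.continuousAt.eventually_ne hlc
    obtain ⟨w, h1, h2, h3, h4⟩ := ((htop.eventually_gt_atTop _).and (hroot.and
      ((hb.filter_mono nhdsWithin_le_nhds).and (hlc'.filter_mono nhdsWithin_le_nhds)))).exists
    have h5 := norm_root_le P h4 h2
    have h6 : 0 < ‖P.leadingCoeff.eval w‖ := norm_pos_iff.2 h4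
    rw [norm_mul, mul_comm, ← le_div_iff₀ h6] at h5
    exact absurd (h5.trans h3) (not_le.2 h1)
  obtain ⟨g, hg, hyg⟩ := hy.meromorphicOrderAt_nonneg_iff.1 hord
  refine ⟨g, hg, hyg, ?_⟩
  have h1 : ∀ᶠ w in 𝓝[≠] k, P.evalEval w (g w) = 0 := by
    filter_upwards [hroot, hyg] with w h1 h2
    rw [← h2]; exact h1
  have hc : ContinuousAt (fun w => P.evalEval w (g w)) k :=
    (contDiff_evalEval P).continuous.continuousAt.comp (continuousAt_id.prodMk hg.continuousAt)
  have h0 : P.evalEval k (g k) = 0 :=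
    tendsto_nhds_unique (hc.mono_left nhdsWithin_le_nhds)
      (tendsto_const_nhds.congr' (h1.mono fun _ h => h.symm))
  rw [eventually_nhdsWithin_iff] at h1
  filter_upwards [h1] with w hw
  by_cases h : w = k
  · rw [h, h0]
  · exact hw h

/-- A local logarithm. -/
theorem exists_local_log {z₀ : ℂ} (hz₀ : z₀ ≠ 0) : ∃ L : ℂ → ℂ, AnalyticAt ℂ L z₀ ∧
    L z₀ = Complex.log z₀ ∧ ∀ z, z ≠ 0 → Complex.exp (L z) = z := by
  refine ⟨fun z => Complex.log (z / z₀) + Complex.log z₀, ?_, by simp [hz₀], fun z hz => ?_⟩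
  · refine AnalyticAt.add (AnalyticAt.clog (by fun_prop) ?_) analyticAt_const
    simp [hz₀]
  · rw [Complex.exp_add, Complex.exp_log (div_ne_zero hz hz₀), Complex.exp_log hz₀]
    field_simp

theorem exists_punctured_ball_eval_ne_zero {q : Polynomial ℂ} (hq : q ≠ 0) (k₀ : ℂ) :
    ∃ ρ : ℝ, 0 < ρ ∧ ∀ z : ℂ, z ≠ 0 → ‖z‖ < ρ → q.eval (k₀ + z) ≠ 0 := by
  have hfin := (q.finite_setOfPred_isRoot hq).subset (Set.sdiff_subset (t := {k₀}))
  have := hfin.isClosed.isOpen_compl.mem_nhds (x := k₀) (by simp)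
  obtain ⟨ρ, hρ, hball⟩ := Metric.mem_nhds_iff.1 this
  refine ⟨ρ, hρ, fun z hz hzρ h0 => ?_⟩
  exact hball (show k₀ + z ∈ Metric.ball k₀ ρ by simpa using hzρ) ⟨h0, by simpa using hz⟩

open Polynomial in
-- The identity shows that roots are simple off the zeros of `R`. Around `k₀` a punctured disc
-- avoids these zeros and those of the leading coefficient, and `k = k₀ + exp w` unrolls it to a
-- half-plane, on which each root becomes a function `Y` with period `M * 2πi`, where `M =
-- natDegree!`. Hence `Y (M * log z)` is single-valued in `z`, and `k = k₀ + z ^ M`. Neither `M` nor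
-- the disc depends on the root.
theorem hasPuiseuxExpansions_of_coprime {P A B : ℂ[X][X]} {R : ℂ[X]} (hP : P ≠ 0) (hR : R ≠ 0)
    (hAB : A * P + B * P.derivative = C R) : HasPuiseuxExpansions P := by
  set M := P.natDegree.factorial with hMdef
  have hM : 0 < M := Nat.factorial_pos _
  refine ⟨M, hM, fun k₀ => ?_⟩
  obtain ⟨ρ, hρ, hq⟩ := exists_punctured_ball_eval_ne_zero
    (mul_ne_zero hR (leadingCoeff_ne_zero.2 hP)) k₀
  set s : Set ℂ := {k | (R * P.leadingCoeff).eval k ≠ 0} with hsdef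
  have hlc : ∀ k ∈ s, P.leadingCoeff.eval k ≠ 0 := fun k hk h => hk (by simp [h])
  have hs : ∀ k ∈ s, ∀ y, P.evalEval k y = 0 → P.derivative.evalEval k y ≠ 0 := by
    intro k hk y h1 h2
    have := congrArg (evalEval k y) hAB
    rw [evalEval_add, evalEval_mul, evalEval_mul, h1, h2, evalEval_C] at this
    exact hk (by simp [← this])
  set H : Set ℂ := {w | w.re < Real.log ρ} with hHdef
  have hH : IsOpen H := isOpen_lt Complex.continuous_re continuous_const
  have hconv : Convex ℝ H := convex_halfSpace_re_lt _
  set φ : ℂ → ℂ := fun w => k₀ + Complex.exp w with hφdef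
  have hφ : Differentiable ℂ φ := by fun_prop
  have hexp : ∀ w ∈ H, ‖Complex.exp w‖ < ρ := fun w hw => by
    rw [Complex.norm_exp, ← Real.lt_log_iff_exp_lt hρ]; exact hw
  have hφs : ∀ w ∈ H, φ w ∈ s := fun w hw => hq _ (Complex.exp_ne_zero w) (hexp w hw)
  set c : ℂ := 2 * Real.pi * Complex.I with hcdef
  have hHc : ∀ (w : ℂ) (j : ℤ), w ∈ H → w + j * c ∈ H := fun w j hw => by
    have : (w + j * c).re = w.re := by simp [c]
    change (w + j * c).re < _
    rw [this]; exact hw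
  have hφc : ∀ (w : ℂ) (j : ℤ), φ (w + j * c) = φ w := fun w j => by
    simp only [φ, c]
    rw [Complex.exp_add, Complex.exp_int_mul_two_pi_mul_I, mul_one]
  refine ⟨min 1 ρ, lt_min one_pos hρ, fun z₁ hz₁ hz₁r y hy hroot => ?_⟩
  have hpow : ∀ z : ℂ, ‖z‖ < min 1 ρ → ‖z ^ M‖ < ρ := fun z hz => by
    rw [norm_pow]
    exact (pow_le_of_le_one (norm_nonneg z) (hz.le.trans (min_le_left _ _)) hM.ne').trans_lt
      (hz.trans_le (min_le_right _ _))
  have hHlog : ∀ w z : ℂ, Complex.exp w = z → ‖z‖ < min 1 ρ → M * w ∈ H := fun w z hw hz => by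
    change (M * w).re < Real.log ρ
    rw [Real.lt_log_iff_exp_lt hρ, ← Complex.norm_exp, Complex.exp_nat_mul, hw]
    exact hpow z hz
  have hk₁ : k₀ + z₁ ^ M ∈ s := hq _ (pow_ne_zero _ hz₁) (hpow z₁ hz₁r)
  obtain ⟨g, hg, hyg, hgroot⟩ := exists_analytic_root P (hlc _ hk₁) hy hroot
  set w₁ : ℂ := M * Complex.log z₁ with hw₁def
  have hw₁ : w₁ ∈ H := hHlog _ z₁ (Complex.exp_log hz₁) hz₁r
  have hφw₁ : φ w₁ = k₀ + z₁ ^ M := by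
    simp only [φ, w₁]; rw [Complex.exp_nat_mul, Complex.exp_log hz₁]
  obtain ⟨Y, hY, hYroot, hY₁⟩ := exists_root_section P hlc hs hH hconv hφ hφs hw₁
    (y₁ := g (k₀ + z₁ ^ M)) (by rw [hφw₁]; exact hgroot.self_of_nhds)
  have hper := exists_period P hlc hs hH hconv ⟨w₁, hw₁⟩ hφ hφs hHc hφc hY hYroot
  set h : ℂ → ℂ := fun z => Y (M * Complex.log z) with hh
  -- Any logarithm of `z` gives the same value, so the cut of the principal logarithm does no harm.
  have hval : ∀ w z : ℂ, Complex.exp w = z → z ≠ 0 → ‖z‖ < min 1 ρ → h z = Y (M * w) := by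
    intro w z hw hz hzr
    obtain ⟨j, hj⟩ := Complex.exp_eq_exp_iff_exists_int.1 ((Complex.exp_log hz).trans hw.symm)
    simp only [h]
    rw [hj, ← hper j (M * w) (hHlog w z hw hzr)]
    push_cast; congr 1; ring
  have hlocal : ∀ z₀ : ℂ, z₀ ≠ 0 → ‖z₀‖ < min 1 ρ → ∃ L : ℂ → ℂ, AnalyticAt ℂ L z₀ ∧
      L z₀ = Complex.log z₀ ∧ (∀ z, z ≠ 0 → Complex.exp (L z) = z) ∧
      ∀ᶠ z in 𝓝 z₀, h z = Y (M * L z) := by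
    intro z₀ hz₀ hz₀r
    obtain ⟨L, hL, hL0, hLexp⟩ := exists_local_log hz₀
    refine ⟨L, hL, hL0, hLexp, ?_⟩
    filter_upwards [continuousAt_id.eventually_ne hz₀,
      continuous_norm.continuousAt.eventually (gt_mem_nhds hz₀r)] with z hz hzr
    exact hval _ z (hLexp z hz) hz hzr
  have hdiff : ∀ z₀ : ℂ, z₀ ≠ 0 → ‖z₀‖ < min 1 ρ → DifferentiableAt ℂ h z₀ := by
    intro z₀ hz₀ hz₀r
    obtain ⟨L, hL, -, hLexp, hev⟩ := hlocal z₀ hz₀ hz₀r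
    refine DifferentiableAt.congr_of_eventuallyEq ?_ hev
    have := hY.differentiableAt (hH.mem_nhds (hHlog (L z₀) z₀ (hLexp z₀ hz₀) hz₀r))
    exact this.comp z₀ (f := fun z => M * L z) (hL.differentiableAt.const_mul _)
  have hball : ∀ᶠ z : ℂ in 𝓝[≠] 0, z ≠ 0 ∧ ‖z‖ < min 1 ρ := by
    filter_upwards [self_mem_nhdsWithin, nhdsWithin_le_nhds (Metric.ball_mem_nhds (0 : ℂ)
      (lt_min one_pos hρ))] with z hz hz'
    exact ⟨hz, by simpa using hz'⟩
  refine ⟨h, fun z hz => ?_, ?_⟩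
  · by_cases hz0 : z = 0
    · subst hz0
      have hbc : ContinuousAt (fun z : ℂ => ∑ i ∈ Finset.range (P.natDegree + 1),
          ‖(P.coeff i).eval (k₀ + z ^ M)‖) 0 := by fun_prop
      have hb := (hbc.eventually (eventually_le_nhds (lt_add_one _))).filter_mono
        (nhdsWithin_le_nhds (s := {0}ᶜ))
      -- At the centre, `h` times the leading coefficient is bounded by Cauchy's bound, so `h` has
      -- at worst a pole.
      refine meromorphicAt_of_mul_bounded (p := fun z => P.leadingCoeff.eval (k₀ + z ^ M))
        (Differentiable.analyticAt (by fun_prop) _) ?_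
        (hball.mono fun z hz => hdiff z hz.1 hz.2)
        (C := (∑ i ∈ Finset.range (P.natDegree + 1), ‖(P.coeff i).eval (k₀ + 0 ^ M)‖) + 1) ?_
      · exact hball.mono fun z hz => hlc _ (hq _ (pow_ne_zero _ hz.1) (hpow z hz.2))
      · filter_upwards [hball, hb] with z hz hzb
        refine (norm_root_le P (hlc _ (hq _ (pow_ne_zero _ hz.1) (hpow z hz.2))) ?_).trans hzb
        have := hYroot _ (hHlog _ z (Complex.exp_log hz.1) hz.2)
        simpa only [φ, Complex.exp_nat_mul, Complex.exp_log hz.1] using this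
    · have hopen : ∀ᶠ u in 𝓝 z, DifferentiableAt ℂ h u := by
        filter_upwards [continuousAt_id.eventually_ne hz0,
          continuous_norm.continuousAt.eventually (gt_mem_nhds hz)] with u h1 h2
        exact hdiff u h1 h2
      exact (Complex.analyticAt_iff_eventually_differentiableAt.2 hopen).meromorphicAt
  · obtain ⟨L, hL, hL0, hLexp, hev⟩ := hlocal z₁ hz₁ hz₁r
    have hLc : ContinuousAt (fun z => (M : ℂ) * L z) z₁ := continuousAt_const.mul hL.continuousAt
    have hLw : (M : ℂ) * L z₁ = w₁ := by rw [hL0]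
    -- Both sides are simple roots over `φ w` with the same value at `w₁`.
    have hYg : ∀ᶠ w in 𝓝 w₁, Y w = g (φ w) := by
      refine eventually_eq_of_simple_root P (φ := φ) (Y₁ := Y) (Y₂ := fun w => g (φ w))
        hφ.continuous.continuousAt (hY.differentiableAt (hH.mem_nhds hw₁)).continuousAt
        (ContinuousAt.comp (f := φ) (by rw [hφw₁]; exact hg.continuousAt)
          hφ.continuous.continuousAt)
        (by rw [hY₁, hφw₁]) (hs _ (hφs _ hw₁) _ (hYroot _ hw₁)) ?_ ?_
      · filter_upwards [hH.mem_nhds hw₁] with u hu using hYroot u hu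
      · have : Tendsto φ (𝓝 w₁) (𝓝 (k₀ + z₁ ^ M)) := by
          rw [← hφw₁]; exact hφ.continuous.continuousAt
        exact this.eventually hgroot
    have hYg' : ∀ᶠ z in 𝓝 z₁, Y (M * L z) = g (φ (M * L z)) := by
      have : Tendsto (fun z => (M : ℂ) * L z) (𝓝 z₁) (𝓝 w₁) := by rw [← hLw]; exact hLc
      exact this.eventually hYg
    have hyg' := (eventually_nhdsNE_pow_iff hM).2 hyg
    filter_upwards [hyg', nhdsWithin_le_nhds hev, nhdsWithin_le_nhds hYg',
      nhdsWithin_le_nhds (continuousAt_id.eventually_ne hz₁)] with z e1 e2 e3 e4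
    rw [e1, e2, e3]
    simp only [φ]
    rw [Complex.exp_nat_mul, hLexp z e4]

theorem MeromorphicAt.evalEval (P : Polynomial (Polynomial ℂ)) {φ y : ℂ → ℂ} {k : ℂ}
    (hy : MeromorphicAt y k) (hφ : AnalyticAt ℂ φ k) :
    MeromorphicAt (fun w => P.evalEval (φ w) (y w)) k := by
  simp only [evalEval_eq_sum]
  refine MeromorphicAt.fun_sum fun i _ => MeromorphicAt.mul ?_ (hy.pow i)
  exact (((P.coeff i).differentiable.analyticAt _).comp hφ).meromorphicAt

/-- Germs of meromorphic functions have no zero divisors. -/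
theorem MeromorphicAt.evalEval_mul_eq_zero {P Q : Polynomial (Polynomial ℂ)} {y : ℂ → ℂ} {k : ℂ}
    (hy : MeromorphicAt y k) (h : ∀ᶠ w in 𝓝[≠] k, (P * Q).evalEval w (y w) = 0) :
    (∀ᶠ w in 𝓝[≠] k, P.evalEval w (y w) = 0) ∨ ∀ᶠ w in 𝓝[≠] k, Q.evalEval w (y w) = 0 := by
  have h' : ∃ᶠ w in 𝓝[≠] k, P.evalEval w (y w) = 0 ∨ Q.evalEval w (y w) = 0 :=
    (h.mono fun w hw => by
      rw [Polynomial.evalEval_mul] at hw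
      exact mul_eq_zero.1 hw).frequently
  rw [frequently_or_distrib] at h'
  exact h'.imp (hy.evalEval P analyticAt_id).frequently_zero_iff_eventuallyEq_zero.1
    (hy.evalEval Q analyticAt_id).frequently_zero_iff_eventuallyEq_zero.1

/-- A root of the product is a root of one factor; its expansion is rewritten for the exponent `M₁ *
M₂` by inserting a power of the parameter, radii below `1` keeping this power in the disc. -/
theorem HasPuiseuxExpansions.mul {P Q : Polynomial (Polynomial ℂ)} (hP : HasPuiseuxExpansions P)
    (hQ : HasPuiseuxExpansions Q) : HasPuiseuxExpansions (P * Q) := by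
  obtain ⟨M₁, hM₁, h₁⟩ := hP
  obtain ⟨M₂, hM₂, h₂⟩ := hQ
  refine ⟨M₁ * M₂, Nat.mul_pos hM₁ hM₂, fun k₀ => ?_⟩
  obtain ⟨r₁, hr₁, h₁⟩ := h₁ k₀
  obtain ⟨r₂, hr₂, h₂⟩ := h₂ k₀
  have hpow : ∀ {z : ℂ} {q : ℕ}, 0 < q → ‖z‖ < min 1 (min r₁ r₂) → ‖z ^ q‖ < min r₁ r₂ := by
    intro z q hq hz
    rw [norm_pow]
    exact (pow_le_of_le_one (norm_nonneg z) (hz.le.trans (min_le_left _ _)) hq.ne').trans_lt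
      (hz.trans_le (min_le_right _ _))
  refine ⟨min 1 (min r₁ r₂), lt_min one_pos (lt_min hr₁ hr₂), fun z₁ hz₁ hz₁r y hy hroot => ?_⟩
  rcases hy.evalEval_mul_eq_zero hroot with h | h
  · rw [mul_comm M₁, pow_mul] at hy h
    obtain ⟨g, hg, hyg⟩ := h₁ (z₁ ^ M₂) (pow_ne_zero _ hz₁)
      ((hpow hM₂ hz₁r).trans_le (min_le_left _ _)) y hy h
    refine ⟨fun u => g (u ^ M₂), fun z hz => ?_, ?_⟩
    · exact (hg _ ((hpow hM₂ hz).trans_le (min_le_left _ _))).comp_analyticAt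
        (g := fun u => u ^ M₂) (by fun_prop)
    · filter_upwards [(eventually_nhdsNE_pow_iff' hM₂).2 hyg] with u hu
      rw [mul_comm M₁, pow_mul]; exact hu
  · rw [pow_mul] at hy h
    obtain ⟨g, hg, hyg⟩ := h₂ (z₁ ^ M₁) (pow_ne_zero _ hz₁)
      ((hpow hM₁ hz₁r).trans_le (min_le_right _ _)) y hy h
    refine ⟨fun u => g (u ^ M₁), fun z hz => ?_, ?_⟩
    · exact (hg _ ((hpow hM₁ hz).trans_le (min_le_right _ _))).comp_analyticAt
        (g := fun u => u ^ M₁) (by fun_prop)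
    · filter_upwards [(eventually_nhdsNE_pow_iff' hM₁).2 hyg] with u hu
      rw [pow_mul]; exact hu

open Polynomial in
theorem hasPuiseuxExpansions_of_natDegree_eq_zero {P : ℂ[X][X]} (hP : P ≠ 0)
    (h : P.natDegree = 0) : HasPuiseuxExpansions P := by
  have hC := eq_C_of_natDegree_eq_zero h
  refine hasPuiseuxExpansions_of_coprime (A := 1) (B := 0) (R := P.coeff 0) hP ?_ ?_
  · intro h0; rw [h0, C_0] at hC; exact hP hC
  · rw [one_mul, zero_mul, add_zero, ← hC]

open Polynomial in
-- The resultant of `P` and `P'` is a combination of both. By Gauss's lemma `P` stays irreducible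
-- over the fraction field of `ℂ[k]`, hence is separable in characteristic zero, and the resultant
-- does not vanish.
theorem hasPuiseuxExpansions_of_irreducible {P : ℂ[X][X]} (hP : Irreducible P) :
    HasPuiseuxExpansions P := by
  by_cases h0 : P.natDegree = 0
  · exact hasPuiseuxExpansions_of_natDegree_eq_zero hP.ne_zero h0
  obtain ⟨A, B, -, -, hAB⟩ := exists_mul_add_mul_eq_C_resultant P P.derivative le_rfl le_rfl
    (Or.inl h0)
  refine hasPuiseuxExpansions_of_coprime (A := A) (B := B) hP.ne_zero ?_
    (by rw [← hAB]; ring)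
  have hinj : Function.Injective (algebraMap ℂ[X] (FractionRing ℂ[X])) :=
    IsFractionRing.injective _ _
  have : CharZero (FractionRing ℂ[X]) := charZero_of_injective_algebraMap hinj
  have hirr := ((hP.isPrimitive h0).irreducible_iff_irreducible_map_fraction_map
    (K := FractionRing ℂ[X])).1 hP
  have hsep := hirr.separable
  rw [Polynomial.separable_def, derivative_map] at hsep
  intro hres
  have := resultant_map_map P P.derivative P.natDegree P.derivative.natDegree
    (algebraMap ℂ[X] (FractionRing ℂ[X]))
  rw [hres, map_zero, ← natDegree_map_eq_of_injective hinj P,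
    ← natDegree_map_eq_of_injective hinj P.derivative] at this
  exact (resultant_eq_zero_iff.1 this).2 hsep

theorem hasPuiseuxExpansions {P : Polynomial (Polynomial ℂ)} (hP : P ≠ 0) :
    HasPuiseuxExpansions P := by
  induction P using WfDvdMonoid.induction_on_irreducible with
  | zero => exact absurd rfl hP
  | unit u hu => exact hasPuiseuxExpansions_of_natDegree_eq_zero hu.ne_zero (Polynomial.natDegree_eq_zero_of_isUnit hu)
  | mul a i ha hi ih => exact (hasPuiseuxExpansions_of_irreducible hi).mul (ih ha)

theorem eventually_nhdsNE_eventually_nhds {z : ℂ} {p : ℂ → Prop} (h : ∀ᶠ u in 𝓝[≠] z, p u) :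
    ∀ᶠ u in 𝓝[≠] z, ∀ᶠ v in 𝓝 u, p v := by
  filter_upwards [eventually_eventually_nhdsWithin.2 h, self_mem_nhdsWithin] with u hu hne
  rwa [IsOpen.nhdsWithin_eq isOpen_compl_singleton hne] at hu

/-! ### Passing to the primitive local parameter -/

section Descent

variable {N : ℕ} {h : ℂ → Matrix (Fin N) (Fin N) ℂ}

/-- The invariance near `0` spreads over the whole disc by the identity theorem and is then
iterated. -/
theorem eventually_rotate_eq {r : ℝ} (hh : ∀ z, ‖z‖ < r → MatMeromorphicAt h z) (hr : 0 < r)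
    {ζ : ℂ} (hζ : ‖ζ‖ = 1) (hinv : ∀ᶠ z in 𝓝[≠] (0 : ℂ), h (ζ * z) = h z) (j : ℕ) {z : ℂ}
    (hz : ‖z‖ < r) : ∀ᶠ u in 𝓝[≠] z, h (ζ ^ j * u) = h u := by
  have hζ0 : ζ ≠ 0 := norm_ne_zero_iff.1 (by rw [hζ]; exact one_ne_zero)
  have hball : ∀ z : ℂ, z ∈ Metric.ball (0 : ℂ) r ↔ ‖z‖ < r := fun z => by simp
  have h1 : ∀ z : ℂ, ‖z‖ < r → ∀ᶠ u in 𝓝[≠] z, h (ζ * u) = h u := fun z hz => by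
    refine MatMeromorphicAt.eventually_eq_of_preconnected (U := Metric.ball (0 : ℂ) r)
      (F := fun u => h (ζ * u)) (convex_ball _ _).isPreconnected (fun u hu => ?_)
      (fun u hu => hh u ((hball u).1 hu)) (x := 0) (by simpa using hr) ((hball z).2 hz) hinv
    refine MatMeromorphicAt.comp_analyticAt (g := fun u => ζ * u) (hh _ ?_) (by fun_prop)
    rw [norm_mul, hζ, one_mul]; exact (hball u).1 hu
  induction j with
  | zero => simp
  | succ j ih =>
    have h2 := (eventually_nhdsNE_mul_iff (pow_ne_zero j hζ0)).2
      (h1 (ζ ^ j * z) (by rw [norm_mul, norm_pow, hζ, one_pow, one_mul]; exact hz))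
    filter_upwards [ih, h2] with u a b
    rw [pow_succ', mul_assoc, b, a]

/-- A function of the local parameter which is invariant under a rotation of order `p` is a function
of the `p`-th power of the parameter. -/
theorem exists_descent_of_isPrimitiveRoot {r : ℝ} (hh : ∀ z, ‖z‖ < r → MatMeromorphicAt h z)
    (hr : 0 < r) {ζ : ℂ} {p : ℕ} (hp : 0 < p) (hζ : IsPrimitiveRoot ζ p)
    (hinv : ∀ᶠ z in 𝓝[≠] (0 : ℂ), h (ζ * z) = h z) :
    ∃ h₁ : ℂ → Matrix (Fin N) (Fin N) ℂ, (∀ w, ‖w‖ < r ^ p → MatMeromorphicAt h₁ w) ∧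
      ∀ z, ‖z‖ < r → ∀ᶠ u in 𝓝[≠] z, h u = h₁ (u ^ p) := by
  have hnorm : ‖ζ‖ = 1 := hζ.norm'_eq_one hp.ne'
  -- The principal root is discontinuous, but two `p`-th roots differ by a power of `ζ`, under which
  -- `h` is invariant off isolated points.
  let root : ℂ → ℂ := fun w => w ^ ((p : ℂ)⁻¹)
  have hroot : ∀ w, root w ^ p = w := fun w => Complex.cpow_nat_inv_pow w hp.ne'
  let h₁ : ℂ → Matrix (Fin N) (Fin N) ℂ := fun w => h (root w)
  have hpt : ∀ u, (∀ j : Fin p, h (ζ ^ (j : ℕ) * u) = h u) → h u = h₁ (u ^ p) := by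
    intro u hu
    have : NeZero p := ⟨hp.ne'⟩
    have hj : ∃ j < p, root (u ^ p) = ζ ^ j * u := by
      by_cases hu0 : u = 0
      · refine ⟨0, hp, ?_⟩
        have := hroot (u ^ p)
        rw [hu0, zero_pow hp.ne'] at this ⊢
        simpa using (pow_eq_zero_iff hp.ne').1 this
      · obtain ⟨j, hj, hj'⟩ := hζ.eq_pow_of_pow_eq_one (ξ := root (u ^ p) / u)
          (by rw [div_pow, hroot, div_self (pow_ne_zero _ hu0)])
        exact ⟨j, hj, by rw [hj']; field_simp⟩
    obtain ⟨j, hj, hj'⟩ := hj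
    change h u = h (root (u ^ p))
    rw [hj', hu ⟨j, hj⟩]
  have hev : ∀ z, ‖z‖ < r → ∀ᶠ u in 𝓝[≠] z, h u = h₁ (u ^ p) := fun z hz => by
    have := eventually_all.2 fun j : Fin p => eventually_rotate_eq hh hr hnorm hinv j hz
    exact this.mono hpt
  refine ⟨h₁, fun w hw => ?_, hev⟩
  have hw' : ‖root w‖ < r := by
    refine lt_of_pow_lt_pow_left₀ p hr.le ?_
    rwa [← norm_pow, hroot]
  by_cases hw0 : w = 0
  · subst hw0
    have hr0 : ‖(0 : ℂ)‖ < r := by simpa using hr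
    intro i j
    obtain ⟨n, hn⟩ := hh 0 hr0 i j
    -- The pole is cancelled by a power of `z ^ p`, so that the bound descends to `w ^ n * h₁ w`
    -- with `w = z ^ p`.
    have hn' : AnalyticAt ℂ (fun z => z ^ (p * n) * h z i j) 0 := by
      have : AnalyticAt ℂ (fun z : ℂ => z ^ (p * n - n) * ((z - 0) ^ n • h z i j)) 0 := by
        exact AnalyticAt.mul (by fun_prop) hn
      refine this.congr (Eventually.of_forall fun z => ?_)
      have : n ≤ p * n := Nat.le_mul_of_pos_left n hp
      simp only [sub_zero, smul_eq_mul]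
      rw [← mul_assoc, ← pow_add, Nat.sub_add_cancel this]
    have hb := (hn'.continuousAt.norm.eventually (eventually_le_nhds (lt_add_one _))).filter_mono
      (nhdsWithin_le_nhds (s := {0}ᶜ))
    have han : ∀ᶠ u in 𝓝[≠] (0 : ℂ), DifferentiableAt ℂ (fun z => h z i j) u :=
      (hh 0 hr0 i j).eventually_analyticAt.mono fun u hu => hu.differentiableAt
    refine meromorphicAt_of_mul_bounded (p := fun w => w ^ n) (by fun_prop)
      (by filter_upwards [self_mem_nhdsWithin] with z hz using pow_ne_zero _ hz) ?_
      (C := ‖(0 : ℂ) ^ (p * n) * h 0 i j‖ + 1) ?_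
    · rw [← eventually_nhdsNE_zero_pow_iff hp]
      filter_upwards [eventually_nhdsNE_eventually_nhds (hev 0 hr0), han, self_mem_nhdsWithin]
        with u h1 h2 h3
      obtain ⟨s, hs, hsu, -, hs'⟩ := exists_local_root h3 hp 0
      rw [zero_add] at hs hsu hs'
      rw [← hsu] at h2
      refine (h2.comp (u ^ p) hs.differentiableAt).congr_of_eventuallyEq ?_
      have hst : Tendsto s (𝓝 (u ^ p)) (𝓝 u) := by
        have := hs.continuousAt.tendsto; rwa [hsu] at this
      filter_upwards [hs', hst.eventually h1] with w hw hw1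
      rw [zero_add] at hw
      simp only [Function.comp_apply]
      rw [hw1, hw]
    · rw [← eventually_nhdsNE_zero_pow_iff hp]
      filter_upwards [hev 0 hr0, hb] with u h1 h2
      rw [← h1, ← pow_mul]; exact h2
  · have hz0 : root w ≠ 0 := fun h0 => hw0 (by rw [← hroot w, h0, zero_pow hp.ne'])
    obtain ⟨H, hH, hHh⟩ := (hh _ hw').exists_comp_pow_eq hp hz0 0
    simp only [zero_add, hroot] at hH hHh
    refine hH.congr ?_
    rw [← hroot w, ← eventually_nhdsNE_pow_iff' hp]
    filter_upwards [nhdsWithin_le_nhds hHh, hev _ hw'] with u h1 h2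
    rw [h1, h2]

/-- If a root of unity of order `p > 1` dividing `M` preserves `h`, then `h` is a function of `z ^
p` and `M` drops to `M / p`; the process ends with pairwise distinct branches. -/
theorem exists_primitive_descent {M : ℕ} (hM : 0 < M) {r : ℝ} (hr : 0 < r)
    (hh : ∀ z, ‖z‖ < r → MatMeromorphicAt h z) :
    ∃ (d m : ℕ) (h₁ : ℂ → Matrix (Fin N) (Fin N) ℂ), 0 < d ∧ 0 < m ∧ d * m = M ∧
      (∀ w, ‖w‖ < r ^ d → MatMeromorphicAt h₁ w) ∧
      (∀ z, ‖z‖ < r → ∀ᶠ u in 𝓝[≠] z, h u = h₁ (u ^ d)) ∧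
      ∀ ζ : ℂ, ζ ^ m = 1 → (∀ᶠ z in 𝓝[≠] (0 : ℂ), h₁ (ζ * z) = h₁ z) → ζ = 1 := by
  induction M using Nat.strong_induction_on generalizing h r with
  | _ M ih =>
    by_cases hprim : ∀ ζ : ℂ, ζ ^ M = 1 → (∀ᶠ z in 𝓝[≠] (0 : ℂ), h (ζ * z) = h z) → ζ = 1
    · exact ⟨1, M, h, one_pos, hM, one_mul M, by simpa using hh, by simp, hprim⟩
    push Not at hprim
    obtain ⟨ζ, hζM, hinv, hζ1⟩ := hprim
    have hp : 0 < orderOf ζ := orderOf_pos_iff.2 (isOfFinOrder_iff_pow_eq_one.2 ⟨M, hM, hζM⟩)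
    have hp1 : orderOf ζ ≠ 1 := fun h1 => hζ1 (orderOf_eq_one_iff.1 h1)
    obtain ⟨M', hM'⟩ := orderOf_dvd_of_pow_eq_one hζM
    set p := orderOf ζ with hpdef
    obtain ⟨h₁, hh₁, he₁⟩ := exists_descent_of_isPrimitiveRoot hh hr hp
      (IsPrimitiveRoot.orderOf ζ) hinv
    have hM'0 : 0 < M' := Nat.pos_of_ne_zero (by rintro rfl; omega)
    have hlt : M' < M := by rw [hM']; exact (Nat.lt_mul_iff_one_lt_left hM'0).2 (by omega)
    obtain ⟨d, m, h₂, hd, hm, hdm, hh₂, he₂, hprim⟩ := ih M' hlt hM'0 (pow_pos hr p) hh₁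
    refine ⟨p * d, m, h₂, Nat.mul_pos hp hd, hm, by rw [mul_assoc, hdm, hM'], ?_, ?_, hprim⟩
    · intro w hw; exact hh₂ w (by rwa [← pow_mul])
    · intro z hz
      have := (eventually_nhdsNE_pow_iff' hp).2 (he₂ (z ^ p) (by rw [norm_pow]; gcongr))
      filter_upwards [he₁ z hz, this] with u a b
      rw [a, b, pow_mul]

end Descent

/-! ### Points and parametrized discs of the surface -/

section Surface

variable {N : ℕ}

namespace FunctionElement

/-- The ordinary element given by the germ of a function. -/
def ofFun (F : ℂ → Matrix (Fin N) (Fin N) ℂ) (k : ℂ) (hF : MatMeromorphicAt F k) :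
    FunctionElement N where
  affix := k
  order := 1
  order_pos := one_pos
  toFun := fun w => F (k + w)
  meromorphic := MatMeromorphicAt.comp_analyticAt (g := fun w => k + w) (by simpa using hF)
    (by fun_prop)
  primitive := fun ζ hζ _ => by simpa using hζ

theorem isGermOf_ofFun {F : ℂ → Matrix (Fin N) (Fin N) ℂ} {k : ℂ} (hF : MatMeromorphicAt F k) :
    IsGermOf (ofFun F k hF) F := ⟨rfl, Eventually.of_forall fun _ => rfl⟩

end FunctionElement

open FunctionElement

theorem SurfacePoint.mk_eq_mk_of_order_one {e e' : FunctionElement N} (ha : e.affix = e'.affix)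
    (ho : e.order = 1) (ho' : e'.order = 1) (h : ∀ᶠ w in 𝓝[≠] (0 : ℂ), e.toFun w = e'.toFun w) :
    SurfacePoint.mk e = SurfacePoint.mk e' :=
  Quotient.sound ⟨ha, ho.trans ho'.symm, 1, one_pow _, h.mono fun w hw => by rw [one_mul, hw]⟩

/-- Rotate `s` by a primitive root `ξ` of order `e₀.order`: the left side is unchanged, so `e₀` is
invariant under `ξ ^ e.order`, which is `1` by primitivity. -/
theorem FunctionElement.order_dvd_of_comp_pow_eq {e e₀ : FunctionElement N}
    (h : ∀ᶠ s in 𝓝[≠] (0 : ℂ), e.toFun (s ^ e₀.order) = e₀.toFun (s ^ e.order)) :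
    e₀.order ∣ e.order := by
  have hξ := Complex.isPrimitiveRoot_exp e₀.order e₀.order_pos.ne'
  set ξ := Complex.exp (2 * Real.pi * Complex.I / e₀.order)
  have hξ0 : ξ ≠ 0 := hξ.ne_zero e₀.order_pos.ne'
  rw [← hξ.pow_eq_one_iff_dvd]
  refine e₀.primitive _ (by rw [← pow_mul, mul_comm, pow_mul, hξ.pow_eq_one, one_pow]) ?_
  have h' : ∀ᶠ s in 𝓝[≠] (0 : ℂ), e.toFun ((ξ * s) ^ e₀.order) = e₀.toFun ((ξ * s) ^ e.order) :=
    (tendsto_mul_punctured hξ0).eventually h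
  rw [← eventually_nhdsNE_zero_pow_iff e.order_pos]
  filter_upwards [h, h'] with s a b
  rw [← mul_pow, ← b, ← a, mul_pow, hξ.pow_eq_one, one_mul]

/-- A point of the surface is determined by its branches. -/
theorem SurfacePoint.mk_eq_mk_of_comp_pow_eq {e e₀ : FunctionElement N} (ha : e.affix = e₀.affix)
    (h : ∀ᶠ s in 𝓝[≠] (0 : ℂ), e.toFun (s ^ e₀.order) = e₀.toFun (s ^ e.order)) :
    SurfacePoint.mk e = SurfacePoint.mk e₀ := by
  have ho : e.order = e₀.order := Nat.dvd_antisymm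
    (order_dvd_of_comp_pow_eq (h.mono fun _ h => h.symm)) (order_dvd_of_comp_pow_eq h)
  refine Quotient.sound ⟨ha, ho, 1, one_pow _, ?_⟩
  rw [← eventually_nhdsNE_zero_pow_iff e.order_pos]
  filter_upwards [h] with s a
  rw [one_mul, ← a, ho]

theorem SurfacePoint.tendsto_mk_of_hasBranchAt {α : Type*} {l : Filter α} {e : FunctionElement N}
    {x : α → SurfacePoint N} {ζ : α → ℂ} (hζ : Tendsto ζ l (𝓝 0))
    (hx : ∀ᶠ a in l, x a = mk e ∨ ζ a ≠ 0 ∧ ∃ e', x a = mk e' ∧ e.HasBranchAt (ζ a) e') :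
    Tendsto x l (𝓝 (mk e)) := by
  rw [tendsto_nhds]
  intro U hU he
  obtain ⟨r, hr, h⟩ := hU e he
  have hζ' : ∀ᶠ a in l, ‖ζ a‖ < r := by
    have := hζ.norm
    rw [norm_zero] at this
    exact this.eventually (gt_mem_nhds hr)
  filter_upwards [hx, hζ'] with a ha har
  rcases ha with ha | ⟨h0, e', ha, hb⟩
  · rw [Set.mem_preimage, ha]; exact he
  · rw [Set.mem_preimage, ha]; exact h _ e' h0 har hb

/-- A disc of the surface, parametrized by `z` with `k = k₀ + z ^ n`, and its central element. -/
structure IsSurfaceDisc (k₀ : ℂ) (n : ℕ) (r : ℝ) (Φ : ℂ → SurfacePoint N)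
    (e : FunctionElement N) (d : ℕ) : Prop where
  continuousOn : ContinuousOn Φ (Metric.ball 0 r)
  affix : ∀ z, ‖z‖ < r → (Φ z).affix = k₀ + z ^ n
  d_pos : 0 < d
  mul_order : d * e.order = n
  center_affix : e.affix = k₀
  center : Φ 0 = SurfacePoint.mk e
  meromorphic : ∀ z, ‖z‖ < r ^ d → MatMeromorphicAt e.toFun z
  branch : ∀ z, z ≠ 0 → ‖z‖ < r → ∃ e' : FunctionElement N, Φ z = SurfacePoint.mk e' ∧
    e'.order = 1 ∧ e'.affix = k₀ + z ^ n ∧ ∀ᶠ u in 𝓝[≠] z, e'.toFun (u ^ n - z ^ n) =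
      e.toFun (u ^ d)

/-- A meromorphic function of a local parameter `z` with `k = k₀ + z ^ M` parametrizes a disc of the
surface. -/
theorem exists_surface_disc (k₀ : ℂ) {M : ℕ} (hM : 0 < M) {r : ℝ} (hr : 0 < r)
    {h : ℂ → Matrix (Fin N) (Fin N) ℂ} (hh : ∀ z, ‖z‖ < r → MatMeromorphicAt h z) :
    ∃ (Φ : ℂ → SurfacePoint N) (e : FunctionElement N) (d : ℕ), IsSurfaceDisc k₀ M r Φ e d ∧
      ∀ z, ‖z‖ < r → ∀ᶠ u in 𝓝[≠] z, h u = e.toFun (u ^ d) := by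
  obtain ⟨d, m, h₁, hd, hm, hdm, hh₁, he₁, hprim⟩ := exists_primitive_descent hM hr hh
  have hr0 : ‖(0 : ℂ)‖ < r := by simpa using hr
  let e₀ : FunctionElement N := ⟨k₀, m, hm, h₁, hh₁ 0 (by simpa using pow_pos hr d), hprim⟩
  have hex : ∀ z, z ≠ 0 → ‖z‖ < r → ∃ e : FunctionElement N, e.order = 1 ∧
      e.affix = k₀ + z ^ M ∧ ∀ᶠ u in 𝓝[≠] z, e.toFun (u ^ M - z ^ M) = h u := by
    intro z hz hzr
    obtain ⟨H, hH, hHh⟩ := (hh z hzr).exists_comp_pow_eq hM hz k₀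
    refine ⟨ofFun H _ hH, rfl, rfl, (hHh.filter_mono nhdsWithin_le_nhds).mono fun u hu => ?_⟩
    simp only [ofFun]
    rw [← hu]; congr 1; ring
  have : Nonempty (FunctionElement N) := ⟨e₀⟩
  choose! E hE1 hEa hE using hex
  classical
  let Φ : ℂ → SurfacePoint N := fun z =>
    if z = 0 then SurfacePoint.mk e₀ else SurfacePoint.mk (E z)
  have hΦ0 : Φ 0 = SurfacePoint.mk e₀ := if_pos rfl
  have hΦ : ∀ z, z ≠ 0 → Φ z = SurfacePoint.mk (E z) := fun z hz => if_neg hz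
  refine ⟨Φ, e₀, d, ⟨fun z hz => ?_, fun z hzr => ?_, hd, hdm, rfl, hΦ0, hh₁, fun z hz hzr =>
    ⟨E z, hΦ z hz, hE1 z hz hzr, hEa z hz hzr, ?_⟩⟩, he₁⟩
  · have hzr : ‖z‖ < r := by simpa using hz
    refine ContinuousAt.continuousWithinAt ?_
    have hnear : ∀ᶠ u in 𝓝 z, ‖u‖ < r := continuous_norm.continuousAt.eventually (gt_mem_nhds hzr)
    by_cases hz0 : z = 0
    · subst hz0
      unfold ContinuousAt
      rw [hΦ0]
      -- At the centre the local parameter of `e₀` is `u ^ d`, since `(u ^ d) ^ m = u ^ M`.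
      refine SurfacePoint.tendsto_mk_of_hasBranchAt (ζ := fun u => u ^ d) ?_ ?_
      · have : Continuous fun u : ℂ => u ^ d := by fun_prop
        simpa [hd.ne'] using this.tendsto 0
      · have h1 := eventually_nhdsNE_eventually_nhds (he₁ 0 hr0)
        rw [eventually_nhdsWithin_iff] at h1
        filter_upwards [hnear, h1] with u hur hu1
        by_cases hu0 : u = 0
        · left; rw [hu0, hΦ0]
        refine Or.inr ⟨pow_ne_zero d hu0, E u, hΦ u hu0, hE1 u hu0 hur, ?_, ?_⟩
        · rw [hEa u hu0 hur, ← hdm, pow_mul]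
        · rw [← eventually_nhdsNE_pow_iff' hd]
          filter_upwards [hE u hu0 hur, nhdsWithin_le_nhds (hu1 hu0)] with v a b
          change (E u).toFun ((v ^ d) ^ m - (u ^ d) ^ m) = h₁ (v ^ d)
          rw [← pow_mul, ← pow_mul, hdm, a, b]
    · unfold ContinuousAt
      rw [hΦ z hz0]
      -- Off the centre the element is ordinary, with the difference of affixes as its parameter.
      refine SurfacePoint.tendsto_mk_of_hasBranchAt (ζ := fun u => u ^ M - z ^ M) ?_ ?_
      · have : Continuous fun u : ℂ => u ^ M - z ^ M := by fun_prop
        simpa using this.tendsto z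
      · have h1 := eventually_nhdsNE_eventually_nhds (hE z hz0 hzr)
        have h2 : ∀ᶠ u in 𝓝[≠] z, u ^ M - z ^ M ≠ 0 := by
          have : ∀ᶠ w in 𝓝[≠] (z ^ M), w - z ^ M ≠ 0 := by
            filter_upwards [self_mem_nhdsWithin] with w hw using sub_ne_zero.2 hw
          exact (eventually_nhdsNE_pow_iff' hM).2 this
        rw [eventually_nhdsWithin_iff] at h1 h2
        filter_upwards [hnear, h1, h2, continuousAt_id.eventually_ne hz0] with u hur hu1 hu2 hu0
        by_cases huz : u = z
        · left; rw [huz, hΦ z hz0]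
        refine Or.inr ⟨hu2 huz, E u, hΦ u hu0, hE1 u hu0 hur, ?_, ?_⟩
        · rw [hEa u hu0 hur, hEa z hz0 hzr, hE1 z hz0 hzr]; ring
        · have h3 : (u ^ M - z ^ M) = -z ^ M + u ^ M := by ring
          rw [h3, ← eventually_nhdsNE_pow_iff hM]
          filter_upwards [hE u hu0 hur, nhdsWithin_le_nhds (hu1 huz)] with v a b
          rw [hE1 z hz0 hzr, pow_one, pow_one]
          rw [show -z ^ M + v ^ M - (-z ^ M + u ^ M) = v ^ M - u ^ M by ring, a, ← b]
          congr 1; ring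
  · by_cases hz0 : z = 0
    · rw [hz0, hΦ0, zero_pow hM.ne', add_zero]; rfl
    · rw [hΦ z hz0]; exact hEa z hz0 hzr
  · filter_upwards [hE z hz hzr, he₁ z hzr] with u a b
    rw [a, b]

end Surface

/-! ### Classes of germs and their uniformization -/

section GermClass

variable {N : ℕ}

/-- The branch at `z` of the multivalued function `h ((k - k₀) ^ (1 / m))` belongs to the class `𝓐`,
where `𝓐 k F` means that the germ of `F` at `k` belongs to the class. -/
def HasBranchIn (𝓐 : ℂ → (ℂ → Matrix (Fin N) (Fin N) ℂ) → Prop) (k₀ : ℂ) (m : ℕ)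
    (h : ℂ → Matrix (Fin N) (Fin N) ℂ) (z : ℂ) : Prop :=
  ∃ F, 𝓐 (k₀ + z ^ m) F ∧ ∀ᶠ u in 𝓝[≠] z, F (k₀ + u ^ m) = h u

/-- All germs of the class near `k₀` are branches of meromorphic functions of
`(k - k₀) ^ (1 / M k₀)`, all of whose branches belong to the class. -/
def IsLocallyUniformized (𝓐 : ℂ → (ℂ → Matrix (Fin N) (Fin N) ℂ) → Prop) (M : ℂ → ℕ) : Prop :=
  ∀ k₀, 0 < M k₀ ∧ ∃ r : ℝ, 0 < r ∧ ∀ z₁ : ℂ, z₁ ≠ 0 → ‖z₁‖ < r → ∀ F, 𝓐 (k₀ + z₁ ^ M k₀) F →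
    ∃ h : ℂ → Matrix (Fin N) (Fin N) ℂ, (∀ z, ‖z‖ < r → MatMeromorphicAt h z) ∧
      (∀ᶠ u in 𝓝[≠] z₁, F (k₀ + u ^ M k₀) = h u) ∧
      ∀ z, z ≠ 0 → ‖z‖ < r → HasBranchIn 𝓐 k₀ (M k₀) h z

variable {𝓐 : ℂ → (ℂ → Matrix (Fin N) (Fin N) ℂ) → Prop} {k₀ : ℂ} {m : ℕ}
  {h h' : ℂ → Matrix (Fin N) (Fin N) ℂ} {z : ℂ}

theorem HasBranchIn.congr (H : HasBranchIn 𝓐 k₀ m h z) (e : ∀ᶠ u in 𝓝[≠] z, h u = h' u) :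
    HasBranchIn 𝓐 k₀ m h' z := by
  obtain ⟨F, hF, hFh⟩ := H
  exact ⟨F, hF, by filter_upwards [hFh, e] with u a b; rw [a, b]⟩

theorem hasBranchIn_comp_pow_iff {q : ℕ} (hq : 0 < q) :
    HasBranchIn 𝓐 k₀ (q * m) (fun t => h (t ^ q)) z ↔ HasBranchIn 𝓐 k₀ m h (z ^ q) := by
  unfold HasBranchIn
  simp only [pow_mul]
  refine exists_congr fun F => and_congr_right fun _ => ?_
  rw [← eventually_nhdsNE_pow_iff' hq]

theorem hasBranchIn_comp_mul_iff {ζ : ℂ} (hζ : ζ ^ m = 1) (hζ0 : ζ ≠ 0) :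
    HasBranchIn 𝓐 k₀ m (fun t => h (ζ * t)) z ↔ HasBranchIn 𝓐 k₀ m h (ζ * z) := by
  unfold HasBranchIn
  rw [mul_pow, hζ, one_mul]
  refine exists_congr fun F => and_congr_right fun _ => ?_
  rw [← eventually_nhdsNE_mul_iff hζ0]
  simp only [mul_pow, hζ, one_mul]

/-- Passing from `e` to its branch `e'` only recentres the parameter, so both have the same branches
near by; this gives openness and closedness of `pointsOver`. -/
theorem FunctionElement.HasBranchAt.eventually_hasBranchIn_iff {e e' : FunctionElement N}
    (hb : e.HasBranchAt z e') : ∀ᶠ u in 𝓝[≠] z,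
      (HasBranchIn 𝓐 e'.affix 1 e'.toFun (u ^ e.order - z ^ e.order) ↔
        HasBranchIn 𝓐 e.affix e.order e.toFun u) := by
  obtain ⟨-, ha, hev⟩ := hb
  filter_upwards [eventually_nhdsNE_eventually_nhds hev] with u hu
  unfold HasBranchIn
  rw [ha]
  have h1 : e.affix + z ^ e.order + (u ^ e.order - z ^ e.order) ^ 1 = e.affix + u ^ e.order := by
    ring
  rw [h1]
  refine exists_congr fun F => and_congr_right fun _ => ?_
  rw [sub_eq_neg_add, ← eventually_nhdsNE_pow_iff e.order_pos]
  refine eventually_congr ((hu.filter_mono nhdsWithin_le_nhds).mono fun v hv => ?_)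
  rw [← sub_eq_neg_add, hv]
  have h2 : e.affix + z ^ e.order + (v ^ e.order - z ^ e.order) ^ 1 = e.affix + v ^ e.order := by
    ring
  rw [h2]

/-- The points of the surface all of whose nearby branches belong to the class. -/
def pointsOver (𝓐 : ℂ → (ℂ → Matrix (Fin N) (Fin N) ℂ) → Prop) : Set (SurfacePoint N) :=
  {x | ∃ e : FunctionElement N, SurfacePoint.mk e = x ∧
    ∀ᶠ z in 𝓝[≠] (0 : ℂ), HasBranchIn 𝓐 e.affix e.order e.toFun z}

/-- Independent of the representative, as two of them differ by a rotation of the parameter that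
fixes `k`. -/
theorem mk_mem_pointsOver_iff {e : FunctionElement N} : SurfacePoint.mk e ∈ pointsOver 𝓐 ↔
    ∀ᶠ z in 𝓝[≠] (0 : ℂ), HasBranchIn 𝓐 e.affix e.order e.toFun z := by
  refine ⟨?_, fun H => ⟨e, rfl, H⟩⟩
  rintro ⟨e', he, H⟩
  obtain ⟨ha, ho, ζ, hζ, hev⟩ := Quotient.exact he
  have hζ0 := e'.ne_zero_of_pow_eq_one hζ
  filter_upwards [eventually_nhdsNE_eventually_nhds hev,
    (FunctionElement.tendsto_mul_punctured hζ0).eventually H] with z h1 h2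
  rw [← ha, ← ho]
  exact ((hasBranchIn_comp_mul_iff hζ hζ0).2 h2).congr
    ((h1.filter_mono nhdsWithin_le_nhds).mono fun _ h => h.symm)

/-- Continuation of a germ of the class along a whole disc in a uniformizing parameter. -/
theorem exists_uniformization {M : ℕ} {r : ℝ}
    (hA : ∀ z₁ : ℂ, z₁ ≠ 0 → ‖z₁‖ < r → ∀ F, 𝓐 (k₀ + z₁ ^ M) F →
      ∃ h : ℂ → Matrix (Fin N) (Fin N) ℂ, (∀ z, ‖z‖ < r → MatMeromorphicAt h z) ∧
        (∀ᶠ u in 𝓝[≠] z₁, F (k₀ + u ^ M) = h u) ∧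
        ∀ z, z ≠ 0 → ‖z‖ < r → HasBranchIn 𝓐 k₀ M h z)
    {e : FunctionElement N} {φ ψ : ℂ → ℂ} (hφ : AnalyticAt ℂ φ 0) (hψ : AnalyticAt ℂ ψ 0)
    (hψ0 : ψ 0 = 0) (hφr : ‖φ 0‖ < r)
    (hφt : ∀ᶠ t in 𝓝 (0 : ℂ), Tendsto φ (𝓝[≠] t) (𝓝[≠] (φ t)))
    (hψt : ∀ᶠ t in 𝓝 (0 : ℂ), Tendsto ψ (𝓝[≠] t) (𝓝[≠] (ψ t)))
    (hφψ : ∀ᶠ t in 𝓝 (0 : ℂ), k₀ + φ t ^ M = e.affix + ψ t ^ e.order)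
    (hφ0 : ∀ᶠ t in 𝓝[≠] (0 : ℂ), φ t ≠ 0)
    (he : ∃ᶠ t in 𝓝[≠] (0 : ℂ), HasBranchIn 𝓐 e.affix e.order e.toFun (ψ t)) :
    ∃ h : ℂ → Matrix (Fin N) (Fin N) ℂ, (∀ z, ‖z‖ < r → MatMeromorphicAt h z) ∧
      (∀ z, z ≠ 0 → ‖z‖ < r → HasBranchIn 𝓐 k₀ M h z) ∧
      ∀ᶠ t in 𝓝[≠] (0 : ℂ), e.toFun (ψ t) = h (φ t) := by
  have hmer : MatMeromorphicAt (fun t => e.toFun (ψ t)) 0 :=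
    MatMeromorphicAt.comp_analyticAt (by rw [hψ0]; exact e.meromorphic) hψ
  have hmer' : ∀ᶠ t in 𝓝 (0 : ℂ), MatMeromorphicAt (fun t => e.toFun (ψ t)) t := by
    have := hmer.eventually
    rw [eventually_nhdsWithin_iff] at this
    filter_upwards [this] with t ht
    by_cases h0 : t = 0
    · rw [h0]; exact hmer
    · exact ht h0
  have hφball : ∀ᶠ t in 𝓝 (0 : ℂ), ‖φ t‖ < r :=
    hφ.continuousAt.norm.eventually (gt_mem_nhds hφr)
  obtain ⟨ρ, hρ, hball⟩ := Metric.eventually_nhds_iff_ball.1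
    (hmer'.and (hφball.and (hφ.eventually_analyticAt.and (hφt.and (hψt.and hφψ)))))
  have hmem : ∀ᶠ t in 𝓝[≠] (0 : ℂ), t ∈ Metric.ball (0 : ℂ) ρ :=
    nhdsWithin_le_nhds (Metric.ball_mem_nhds _ hρ)
  -- A single small `t ≠ 0` with a branch in the class suffices: that branch is uniformized on the
  -- whole disc, and the identity theorem carries the equality from `t` back to `0`.
  obtain ⟨t, ⟨F, hF, hFe⟩, ht0, ht⟩ := (he.and_eventually (hφ0.and hmem)).exists
  obtain ⟨-, htr, -, htφ, htψ, htφψ⟩ := hball t ht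
  rw [← htφψ] at hF
  obtain ⟨h, hh, hFh, hbr⟩ := hA (φ t) ht0 htr F hF
  refine ⟨h, hh, hbr, ?_⟩
  refine MatMeromorphicAt.eventually_eq_of_preconnected (U := Metric.ball (0 : ℂ) ρ)
    (F := fun t => e.toFun (ψ t)) (H := fun t => h (φ t))
    (convex_ball _ _).isPreconnected (fun s hs => (hball s hs).1) (fun s hs => ?_) ht
    (Metric.mem_ball_self hρ) ?_
  · exact MatMeromorphicAt.comp_analyticAt (hh _ (hball s hs).2.1) (hball s hs).2.2.1
  · filter_upwards [htψ.eventually hFe, htφ.eventually hFh,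
      nhdsWithin_le_nhds (Metric.isOpen_ball.mem_nhds ht)] with s a b c
    rw [← a, ← b, (hball s c).2.2.2.2.2]

end GermClass

theorem tendsto_pow_nhdsNE {q : ℕ} (hq : 0 < q) (c t : ℂ) :
    Tendsto (fun u => c + u ^ q) (𝓝[≠] t) (𝓝[≠] (c + t ^ q)) :=
  (map_nhdsNE_pow hq c t).le

theorem tendsto_pow_nhdsNE' {q : ℕ} (hq : 0 < q) (t : ℂ) :
    Tendsto (fun u => u ^ q) (𝓝[≠] t) (𝓝[≠] (t ^ q)) := by
  simpa using tendsto_pow_nhdsNE hq 0 t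

/-! ### The points over a locally uniformized class -/

section PointsOver

variable {N : ℕ} {𝓐 : ℂ → (ℂ → Matrix (Fin N) (Fin N) ℂ) → Prop} {M : ℂ → ℕ}

open FunctionElement

/-- Branches of the class arbitrarily close to the centre suffice, since one of them determines a
uniformizing function with all its branches in the class. The parameters `z` of `e` and of the
uniformization are compared through a common `t`, as `t ^ n` and `t ^ e.order`. -/
theorem mk_mem_pointsOver_of_frequently (hA : IsLocallyUniformized 𝓐 M) {e : FunctionElement N}
    (he : ∃ᶠ z in 𝓝[≠] (0 : ℂ), HasBranchIn 𝓐 e.affix e.order e.toFun z) :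
    SurfacePoint.mk e ∈ pointsOver 𝓐 := by
  obtain ⟨hM, r, hr, hA⟩ := hA e.affix
  set n := M e.affix
  have hm := e.order_pos
  have h0n : (0 : ℂ) ^ n = 0 := zero_pow hM.ne'
  have h0m : (0 : ℂ) ^ e.order = 0 := zero_pow hm.ne'
  have he' : ∃ᶠ t in 𝓝[≠] (0 : ℂ), HasBranchIn 𝓐 e.affix e.order e.toFun (t ^ n) := by
    intro hne
    exact he ((eventually_nhdsNE_zero_pow_iff hM
      (p := fun z => ¬ HasBranchIn 𝓐 e.affix e.order e.toFun z)).1 hne)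
  obtain ⟨h, hh, hbr, heq⟩ := exists_uniformization hA (e := e) (φ := fun t => t ^ e.order)
    (ψ := fun t => t ^ n) (by fun_prop) (by fun_prop) h0n
    (by rw [h0m, norm_zero]; exact hr)
    (Eventually.of_forall fun t => tendsto_pow_nhdsNE' hm t)
    (Eventually.of_forall fun t => tendsto_pow_nhdsNE' hM t)
    (Eventually.of_forall fun t => by ring)
    (by filter_upwards [self_mem_nhdsWithin] with t ht using pow_ne_zero _ ht) he'
  rw [mk_mem_pointsOver_iff, ← eventually_nhdsNE_zero_pow_iff hM]
  have hnear : ∀ᶠ t in 𝓝[≠] (0 : ℂ), ‖t ^ e.order‖ < r := by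
    have : ContinuousAt (fun t : ℂ => ‖t ^ e.order‖) 0 := by fun_prop
    have h0 : ‖(0 : ℂ) ^ e.order‖ < r := by rwa [h0m, norm_zero]
    exact (this.eventually (gt_mem_nhds h0)).filter_mono nhdsWithin_le_nhds
  filter_upwards [hnear, self_mem_nhdsWithin, eventually_nhdsNE_eventually_nhds heq]
    with t h1 h2 h3
  have h4 := (hasBranchIn_comp_pow_iff hm).2 (hbr (t ^ e.order) (pow_ne_zero _ h2) h1)
  rw [← hasBranchIn_comp_pow_iff hM, mul_comm]
  exact h4.congr ((h3.filter_mono nhdsWithin_le_nhds).mono fun _ h => h.symm)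

/-- Openness follows by recentring. For closedness, a point with every neighbourhood meeting the set
has branches of the class arbitrarily close to its centre, and the preceding lemma applies. -/
theorem isClopen_pointsOver (hA : IsLocallyUniformized 𝓐 M) : IsClopen (pointsOver 𝓐) := by
  constructor
  · rw [← isOpen_compl_iff]
    intro e he
    by_contra hne
    push Not at hne
    refine he (mk_mem_pointsOver_of_frequently hA fun hev => ?_)
    obtain ⟨r, hr, hball⟩ := Metric.mem_nhdsWithin_iff.1 hev
    obtain ⟨z, e', hz, hzr, hb, hmem⟩ := hne r hr
    rw [Set.mem_compl_iff, not_not, mk_mem_pointsOver_iff] at hmem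
    have h1 : ∀ᶠ u in 𝓝[≠] z,
        HasBranchIn 𝓐 e'.affix 1 e'.toFun (u ^ e.order - z ^ e.order) := by
      have : (0 : ℂ) = -z ^ e.order + z ^ e.order := by ring
      simp only [sub_eq_neg_add]
      rw [eventually_nhdsNE_pow_iff e.order_pos (p := HasBranchIn 𝓐 e'.affix 1 e'.toFun), ← this,
        ← hb.1]
      exact hmem
    have h2 : ∀ᶠ u in 𝓝[≠] z, u ≠ 0 ∧ ‖u‖ < r :=
      ((continuousAt_id.eventually_ne hz).and
        (continuous_norm.continuousAt.eventually (gt_mem_nhds hzr))).filter_mono nhdsWithin_le_nhds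
    obtain ⟨u, hu1, hu2, hu3, hu4⟩ :=
      (h1.and ((hb.eventually_hasBranchIn_iff (𝓐 := 𝓐)).and h2)).exists
    exact hball ⟨by simpa using hu4, hu3⟩ (hu2.1 hu1)
  · intro e he
    rw [mk_mem_pointsOver_iff] at he
    obtain ⟨r, hr, hball⟩ := Metric.mem_nhdsWithin_iff.1 he
    refine ⟨r, hr, fun z e' hz hzr hb => ?_⟩
    rw [mk_mem_pointsOver_iff, hb.1]
    have : (0 : ℂ) = -z ^ e.order + z ^ e.order := by ring
    rw [this, ← eventually_nhdsNE_pow_iff e.order_pos]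
    have h2 : ∀ᶠ u in 𝓝[≠] z, u ≠ 0 ∧ ‖u‖ < r :=
      ((continuousAt_id.eventually_ne hz).and
        (continuous_norm.continuousAt.eventually (gt_mem_nhds hzr))).filter_mono nhdsWithin_le_nhds
    filter_upwards [hb.eventually_hasBranchIn_iff (𝓐 := 𝓐), h2] with u h3 h4
    rw [← sub_eq_neg_add]
    exact h3.2 (hball ⟨by simpa using h4.2, h4.1⟩)

/-- A point over a point of the disc of uniformization lies on a parametrized disc of the surface. -/
theorem exists_surface_disc_through (k₀ : ℂ) {n : ℕ} (hn : 0 < n) {r : ℝ} (hr : 0 < r)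
    (hA : ∀ z₁ : ℂ, z₁ ≠ 0 → ‖z₁‖ < r → ∀ F, 𝓐 (k₀ + z₁ ^ n) F →
      ∃ h : ℂ → Matrix (Fin N) (Fin N) ℂ, (∀ z, ‖z‖ < r → MatMeromorphicAt h z) ∧
        (∀ᶠ u in 𝓝[≠] z₁, F (k₀ + u ^ n) = h u) ∧
        ∀ z, z ≠ 0 → ‖z‖ < r → HasBranchIn 𝓐 k₀ n h z)
    {x : SurfacePoint N} (hx : x ∈ pointsOver 𝓐) {z₁ : ℂ} (hz₁ : ‖z₁‖ < r)
    (hxa : x.affix = k₀ + z₁ ^ n) :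
    ∃ (Φ : ℂ → SurfacePoint N) (e : FunctionElement N) (d : ℕ),
      IsSurfaceDisc k₀ n r Φ e d ∧ Φ z₁ = x := by
  obtain ⟨e, rfl, he⟩ := hx
  have hea : e.affix = k₀ + z₁ ^ n := hxa
  have hm := e.order_pos
  have h0n : (0 : ℂ) ^ n = 0 := zero_pow hn.ne'
  have h0m : (0 : ℂ) ^ e.order = 0 := zero_pow hm.ne'
  by_cases h0 : z₁ = 0
  · subst h0
    rw [h0n, add_zero] at hea
    have he' : ∃ᶠ t in 𝓝[≠] (0 : ℂ), HasBranchIn 𝓐 e.affix e.order e.toFun (t ^ n) :=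
      ((eventually_nhdsNE_zero_pow_iff hn).2 he).frequently
    obtain ⟨h, hh, -, heq⟩ := exists_uniformization hA (e := e) (φ := fun t => t ^ e.order)
      (ψ := fun t => t ^ n) (by fun_prop) (by fun_prop) h0n
      (by rw [h0m, norm_zero]; exact hr)
      (Eventually.of_forall fun t => tendsto_pow_nhdsNE' hm t)
      (Eventually.of_forall fun t => tendsto_pow_nhdsNE' hn t)
      (Eventually.of_forall fun t => by rw [hea]; ring)
      (by filter_upwards [self_mem_nhdsWithin] with t ht using pow_ne_zero _ ht) he'
    obtain ⟨Φ, e₀, d, D, he₀⟩ := exists_surface_disc k₀ hn hr hh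
    refine ⟨Φ, e₀, d, D, ?_⟩
    rw [D.center]
    refine (SurfacePoint.mk_eq_mk_of_comp_pow_eq (hea.trans D.center_affix.symm) ?_).symm
    rw [← eventually_nhdsNE_zero_pow_iff D.d_pos]
    have h1 : ∀ᶠ t in 𝓝[≠] (0 : ℂ), h (t ^ e.order) = e₀.toFun ((t ^ e.order) ^ d) :=
      (eventually_nhdsNE_zero_pow_iff hm).2 (he₀ 0 hz₁)
    filter_upwards [heq, h1] with t a b
    rw [← pow_mul, D.mul_order, a, b, ← pow_mul, ← pow_mul, mul_comm]
  · obtain ⟨s, hs, hs1, -, hsr⟩ := exists_local_root h0 hn k₀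
    rw [← hea] at hs hs1 hsr
    have hst : Tendsto (fun t : ℂ => e.affix + t ^ e.order) (𝓝 0) (𝓝 e.affix) := by
      have : Continuous fun t : ℂ => e.affix + t ^ e.order := by fun_prop
      simpa [h0m] using this.tendsto 0
    have hφ : AnalyticAt ℂ (fun t => s (e.affix + t ^ e.order)) 0 := by
      refine AnalyticAt.fun_comp ?_ (by fun_prop)
      rw [h0m, add_zero]; exact hs
    have hφ0 : s (e.affix + 0 ^ e.order) = z₁ := by rw [h0m, add_zero, hs1]
    have hφt : ∀ᶠ t in 𝓝 (0 : ℂ), Tendsto (fun t => s (e.affix + t ^ e.order)) (𝓝[≠] t)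
        (𝓝[≠] (s (e.affix + t ^ e.order))) := by
      filter_upwards [hst.eventually hs.eventually_analyticAt,
        hst.eventually hsr.eventually_nhds] with t h1 h2
      have h3 : Tendsto s (𝓝[≠] (e.affix + t ^ e.order)) (𝓝[≠] (s (e.affix + t ^ e.order))) := by
        refine tendsto_nhdsWithin_iff.2 ⟨h1.continuousAt.mono_left nhdsWithin_le_nhds, ?_⟩
        filter_upwards [nhdsWithin_le_nhds h2, self_mem_nhdsWithin] with w hw hne heq
        exact hne (by rw [Set.mem_singleton_iff, ← hw, heq, h2.self_of_nhds])
      exact h3.comp (tendsto_pow_nhdsNE hm e.affix t)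
    obtain ⟨h, hh, -, heq⟩ := exists_uniformization hA (e := e)
      (φ := fun t => s (e.affix + t ^ e.order)) (ψ := fun t => t) hφ analyticAt_id rfl
      (by rw [hφ0]; exact hz₁) hφt (Eventually.of_forall fun t => tendsto_id)
      (hst.eventually hsr)
      ((hφ.continuousAt.eventually_ne (by rw [hφ0]; exact h0)).filter_mono nhdsWithin_le_nhds)
      he.frequently
    obtain ⟨Φ, e₀, d, D, he₀⟩ := exists_surface_disc k₀ hn hr hh
    refine ⟨Φ, e₀, d, D, ?_⟩
    obtain ⟨e₁, hΦ1, ho₁, ha₁, he₁⟩ := D.branch z₁ h0 hz₁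
    rw [hΦ1]
    refine (SurfacePoint.mk_eq_mk_of_comp_pow_eq (hea.trans ha₁.symm) ?_).symm
    have h1 := hφt.self_of_nhds
    rw [hφ0] at h1
    filter_upwards [heq, h1.eventually he₁, h1.eventually (he₀ z₁ hz₁),
      nhdsWithin_le_nhds (hst.eventually hsr)] with t a b b' c
    rw [ho₁, pow_one, a, b', ← b]
    congr 1
    rw [hea] at c ⊢
    linear_combination c

/-- The point is the centre of a disc with exponent `M x.affix`, which is `d` times its order. -/
theorem order_dvd_of_mem_pointsOver (hA : IsLocallyUniformized 𝓐 M) {x : SurfacePoint N}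
    (hx : x ∈ pointsOver 𝓐) : x.order ∣ M x.affix := by
  obtain ⟨hM, r, hr, hA⟩ := hA x.affix
  obtain ⟨Φ, e, d, D, hΦ⟩ := exists_surface_disc_through x.affix hM hr hA hx (z₁ := 0)
    (by simpa using hr) (by rw [zero_pow hM.ne', add_zero])
  have hd : e.order ∣ M x.affix := Dvd.intro_left d D.mul_order
  have ho : x.order = e.order := by rw [← hΦ, D.center]; rfl
  rwa [ho]

end PointsOver

/-! ### Roots along paths and lifting of paths -/

/-- Where `γ ≠ 0` the root is a lift through the covering `z ↦ z ^ M`. At an end point with `γ = 0`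
it is extended by `0`, continuously because `‖z‖ ^ M = ‖γ‖`. For `M = 1` interior zeros are
harmless. -/
theorem exists_continuousOn_root {γ : ℝ → ℂ} (hγ : Continuous γ) {M : ℕ} (hM : 0 < M) {a b : ℝ}
    (hab : a ≤ b) (hne : M = 1 ∨ ∀ t, a < t → t < b → γ t ≠ 0) {z₁ : ℂ} (hz₁ : z₁ ^ M = γ a) :
    ∃ z : ℝ → ℂ, ContinuousOn z (Set.Icc a b) ∧ (∀ t ∈ Set.Icc a b, z t ^ M = γ t) ∧
      z a = z₁ := by
  rcases hne with rfl | hne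
  · exact ⟨γ, hγ.continuousOn, fun t _ => pow_one _, by rw [← hz₁, pow_one]⟩
  rcases hab.eq_or_lt with rfl | hab
  · refine ⟨fun _ => z₁, continuousOn_const, fun t ht => ?_, rfl⟩
    rw [hz₁, le_antisymm ht.1 ht.2]
  let g : ℝ → ℂ := fun t => γ (max a (min t b))
  have hg : Continuous g := by fun_prop
  have hgγ : ∀ t ∈ Set.Icc a b, g t = γ t := fun t ht => by
    simp only [g]; rw [min_eq_left ht.2, max_eq_right ht.1]
  -- An end point where `γ` vanishes is removed; past any other end point `J` runs to infinity, `g`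
  -- being constant there. So `J` is open, convex and free of zeros of `g`.
  let J : Set ℝ := {t | (a < t ∨ γ a ≠ 0) ∧ (t < b ∨ γ b ≠ 0)}
  have hJo : IsOpen J := by
    refine IsOpen.inter (IsOpen.union (isOpen_lt continuous_const continuous_id) ?_)
      (IsOpen.union (isOpen_lt continuous_id continuous_const) ?_) <;> exact isOpen_const
  have hJc : Convex ℝ J := by
    refine Set.OrdConnected.convex ⟨fun x hx y hy t ht => ?_⟩
    exact ⟨hx.1.imp_left fun h => h.trans_le ht.1, hy.2.imp_left fun h => ht.2.trans_lt h⟩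
  have hgJ : ∀ t ∈ J, g t ≠ 0 := by
    rintro t ⟨h1, h2⟩
    simp only [g]
    rcases le_or_gt t a with hta | hta
    · rw [min_eq_left (hta.trans hab.le), max_eq_left hta]
      exact h1.resolve_left (not_lt.2 hta)
    rcases le_or_gt b t with htb | htb
    · rw [min_eq_right htb, max_eq_right hab.le]
      exact h2.resolve_left (not_lt.2 htb)
    · rw [min_eq_left htb.le, max_eq_right hta.le]
      exact hne t hta htb
  -- The lift starts with the prescribed root at `a` if `γ a ≠ 0`. Otherwise `z₁ = 0` is forced, and
  -- any root at the midpoint will do.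
  obtain ⟨t₁, y₁, ht₁, hy₁, hstart⟩ : ∃ (t₁ : ℝ) (y₁ : ℂ), t₁ ∈ J ∧ y₁ ^ M = g t₁ ∧
      (a ∈ J → t₁ = a ∧ y₁ = z₁) := by
    by_cases haJ : a ∈ J
    · exact ⟨a, z₁, haJ, by rw [hz₁, hgγ a ⟨le_rfl, hab.le⟩], fun _ => ⟨rfl, rfl⟩⟩
    · obtain ⟨y, hy⟩ := exists_pow_eq hM (g ((a + b) / 2))
      exact ⟨(a + b) / 2, y, ⟨Or.inl (by linarith), Or.inl (by linarith)⟩, hy,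
        fun h => absurd h haJ⟩
  have : LocallyPathConnectedSpace J := hJo.locallyPathConnectedSpace
  have : ContractibleSpace J := hJc.contractibleSpace ⟨t₁, ht₁⟩
  have hcov := isCoveringMapOn_npow (𝕜 := ℂ) M (by exact_mod_cast hM.ne')
  obtain ⟨Z, ⟨hZ1, hZ⟩, -⟩ := hcov.existsUnique_continuousMap_lifts
    (⟨fun t : J => g t, by fun_prop⟩ : C(J, ℂ)) (a₀ := ⟨t₁, ht₁⟩) (e₀ := y₁) hy₁
    (fun t => hgJ t t.2)
  have hZp : ∀ t : J, Z t ^ M = g t := fun t => congrFun hZ t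
  classical
  let z : ℝ → ℂ := fun t => if h : t ∈ J then Z ⟨t, h⟩ else 0
  have hzJ : ∀ t : J, z t = Z t := fun t => by simp [z]
  have hJ0 : ∀ t ∈ Set.Icc a b, t ∉ J → γ t = 0 := by
    intro t ht htJ
    by_contra h0
    refine htJ ⟨?_, ?_⟩
    · rcases ht.1.eq_or_lt with h | h
      · right; rwa [h]
      · exact Or.inl h
    · rcases ht.2.eq_or_lt with h | h
      · right; rwa [← h]
      · exact Or.inl h
  have hpow : ∀ t ∈ Set.Icc a b, z t ^ M = γ t := by
    intro t ht
    by_cases htJ : t ∈ J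
    · rw [hzJ ⟨t, htJ⟩, hZp ⟨t, htJ⟩, hgγ t ht]
    · rw [hJ0 t ht htJ]; simp only [z, dif_neg htJ]; exact zero_pow hM.ne'
  refine ⟨z, fun t ht => ?_, hpow, ?_⟩
  · by_cases htJ : t ∈ J
    · have : ContinuousOn z J := by
        rw [continuousOn_iff_continuous_domRestrict]
        have : J.domRestrict z = Z := funext hzJ
        rw [this]; exact Z.continuous
      exact (this.continuousAt (hJo.mem_nhds htJ)).continuousWithinAt
    · have hzt : z t = 0 := dif_neg htJ
      unfold ContinuousWithinAt
      rw [hzt, Metric.tendsto_nhds]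
      intro ε hε
      have h1 : ∀ᶠ s in 𝓝[Set.Icc a b] t, ‖γ s‖ < ε ^ M := by
        have h0 : ‖γ t‖ < ε ^ M := by rw [hJ0 t ht htJ, norm_zero]; positivity
        exact (hγ.norm.continuousAt.eventually (gt_mem_nhds h0)).filter_mono nhdsWithin_le_nhds
      filter_upwards [h1, self_mem_nhdsWithin] with s hs hs'
      rw [dist_zero_right]
      refine lt_of_pow_lt_pow_left₀ M hε.le ?_
      rwa [← norm_pow, hpow s hs']
  · by_cases haJ : a ∈ J
    · obtain ⟨rfl, rfl⟩ := hstart haJ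
      rw [hzJ ⟨_, ht₁⟩, hZ1]
    · have h0 := hJ0 a ⟨le_rfl, hab.le⟩ haJ
      rw [h0] at hz₁
      rw [(pow_eq_zero_iff hM.ne').1 hz₁]
      exact dif_neg haJ

section PathLifting

variable {N : ℕ} {𝓐 : ℂ → (ℂ → Matrix (Fin N) (Fin N) ℂ) → Prop} {M : ℂ → ℕ}

/-- Lifting of paths in a disc of uniformization. -/
theorem exists_lift_in_disc (k₀ : ℂ) {n : ℕ} (hn : 0 < n) {r : ℝ} (hr : 0 < r)
    (hA : ∀ z₁ : ℂ, z₁ ≠ 0 → ‖z₁‖ < r → ∀ F, 𝓐 (k₀ + z₁ ^ n) F →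
      ∃ h : ℂ → Matrix (Fin N) (Fin N) ℂ, (∀ z, ‖z‖ < r → MatMeromorphicAt h z) ∧
        (∀ᶠ u in 𝓝[≠] z₁, F (k₀ + u ^ n) = h u) ∧
        ∀ z, z ≠ 0 → ‖z‖ < r → HasBranchIn 𝓐 k₀ n h z)
    {γ : ℝ → ℂ} (hγ : Continuous γ) {a b : ℝ} (hab : a ≤ b)
    (hγr : ∀ t ∈ Set.Icc a b, ‖γ t - k₀‖ < r ^ n)
    (hne : n = 1 ∨ ∀ t, a < t → t < b → γ t ≠ k₀) {x : SurfacePoint N} (hx : x ∈ pointsOver 𝓐)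
    (hxa : x.affix = γ a) :
    ∃ Γ : ℝ → SurfacePoint N, ContinuousOn Γ (Set.Icc a b) ∧ Γ a = x ∧
      ∀ t ∈ Set.Icc a b, (Γ t).affix = γ t := by
  obtain ⟨z₁, hz₁⟩ := exists_pow_eq hn (γ a - k₀)
  obtain ⟨z, hz, hzp, hza⟩ := exists_continuousOn_root (γ := fun t => γ t - k₀) (by fun_prop) hn
    hab (hne.imp_right fun h t h1 h2 => sub_ne_zero.2 (h t h1 h2)) hz₁
  have hzr : ∀ t ∈ Set.Icc a b, ‖z t‖ < r := fun t ht => by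
    refine lt_of_pow_lt_pow_left₀ n hr.le ?_
    rw [← norm_pow, hzp t ht]; exact hγr t ht
  have ha : a ∈ Set.Icc a b := ⟨le_rfl, hab⟩
  obtain ⟨Φ, e₀, d, D, hΦ1⟩ := exists_surface_disc_through k₀ hn hr hA hx (z₁ := z₁)
    (by rw [← hza]; exact hzr a ha) (by rw [hz₁, hxa]; ring)
  refine ⟨fun t => Φ (z t), D.continuousOn.comp hz fun t ht => by simpa using hzr t ht, ?_, fun t ht => ?_⟩
  · simp only [hza, hΦ1]
  · rw [D.affix _ (hzr t ht), hzp t ht]; ring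

/-- Lebesgue subdivision into pieces lying in discs of uniformization, lifted one after another; the
clopen set `pointsOver` contains the end of each lifted piece, so the next can start. -/
theorem exists_lift_of_mem_pointsOver (hA : IsLocallyUniformized 𝓐 M) {T : Set ℂ}
    (hT : ∀ k, k ∉ T → M k = 1) {x : SurfacePoint N} (hx : x ∈ pointsOver 𝓐)
    (γ : C(unitInterval, ℂ)) (hγx : γ 0 = x.affix)
    (hγ : ∀ t : unitInterval, 0 < t → t < 1 → γ t ∉ T) :
    ∃ Γ : C(unitInterval, SurfacePoint N), Γ 0 = x ∧ ∀ t, (Γ t).affix = γ t := by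
  choose hM r hr hA' using hA
  let g : ℝ → ℂ := fun t => γ (Set.projIcc 0 1 zero_le_one t)
  have hg : Continuous g := γ.continuous.comp continuous_projIcc
  have hgγ : ∀ t : unitInterval, g t = γ t := fun t => by
    simp only [g]; rw [Set.projIcc_val]
  obtain ⟨t, ht0, htm, ⟨n, hn⟩, ht⟩ := exists_monotone_Icc_subset_open_cover_unitInterval
    (c := fun k : ℂ => {s : unitInterval | ‖γ s - k‖ < r k ^ M k})
    (fun k => isOpen_lt (by fun_prop) continuous_const) (fun s _ => by
      refine Set.mem_iUnion.2 ⟨γ s, ?_⟩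
      change ‖γ s - γ s‖ < _
      rw [sub_self, norm_zero]; exact pow_pos (hr _) _)
  have key : ∀ i : ℕ, ∃ Γ : ℝ → SurfacePoint N, ContinuousOn Γ (Set.Icc 0 (t i : ℝ)) ∧ Γ 0 = x ∧
      ∀ s ∈ Set.Icc 0 (t i : ℝ), (Γ s).affix = g s := by
    intro i
    induction i with
    | zero =>
      refine ⟨fun _ => x, continuousOn_const, rfl, fun s hs => ?_⟩
      rw [ht0] at hs
      have : s = ((0 : unitInterval) : ℝ) := le_antisymm hs.2 hs.1
      rw [this, hgγ, hγx]
    | succ i ih =>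
      obtain ⟨Γ, hΓ, hΓ0, hΓa⟩ := ih
      obtain ⟨k, hk⟩ := ht i
      have h0i : (0 : ℝ) ≤ t i := (t i).2.1
      have hle : (t i : ℝ) ≤ t (i + 1) := htm (Nat.le_succ i)
      have hmem : (t i : ℝ) ∈ Set.Icc 0 (t i : ℝ) := ⟨h0i, le_rfl⟩
      have hΓi : Γ (t i) ∈ pointsOver 𝓐 := by
        have hpre := isPreconnected_Icc.image Γ hΓ
        refine hpre.subset_isClopen
          (isClopen_pointsOver (M := M) fun k => ⟨hM k, r k, hr k, hA' k⟩)
          ⟨x, ⟨0, ⟨le_rfl, h0i⟩, hΓ0⟩, hx⟩ ⟨_, hmem, rfl⟩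
      have hsub : ∀ s ∈ Set.Icc (t i : ℝ) (t (i + 1)), ∃ h : s ∈ Set.Icc (0 : ℝ) 1,
          (⟨s, h⟩ : unitInterval) ∈ Set.Icc (t i) (t (i + 1)) := fun s hs =>
        ⟨⟨h0i.trans hs.1, hs.2.trans (t (i + 1)).2.2⟩, hs.1, hs.2⟩
      obtain ⟨Γ', hΓ', hΓ'0, hΓ'a⟩ := exists_lift_in_disc k (hM k) (hr k) (hA' k) hg hle
        (fun s hs => by
          obtain ⟨h, hs'⟩ := hsub s hs
          have : ‖γ ⟨s, h⟩ - k‖ < r k ^ M k := hk hs'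
          rwa [← hgγ ⟨s, h⟩] at this)
        (by
          -- The path may pass through the centre `k` of a disc only if `k ∉ T`, and then the
          -- exponent is `1` and no root is taken.
          by_cases hkT : k ∈ T
          · right
            intro s hs1 hs2 heq
            obtain ⟨h, -⟩ := hsub s ⟨hs1.le, hs2.le⟩
            refine hγ ⟨s, h⟩ (h0i.trans_lt hs1) (hs2.trans_le (t (i + 1)).2.2) ?_
            rw [← hgγ ⟨s, h⟩, heq]; exact hkT
          · exact Or.inl (hT k hkT)) hΓi (hΓa _ hmem)
      classical
      let Γ₁ : ℝ → SurfacePoint N := fun s => if s ≤ t i then Γ s else Γ' s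
      have e1 : ∀ s ∈ Set.Icc 0 (t i : ℝ), Γ₁ s = Γ s := fun s hs => if_pos hs.2
      have e2 : ∀ s ∈ Set.Icc (t i : ℝ) (t (i + 1)), Γ₁ s = Γ' s := fun s hs => by
        by_cases hsi : s ≤ t i
        · have : s = t i := le_antisymm hsi hs.1
          rw [this, e1 _ hmem, hΓ'0]
        · exact if_neg hsi
      have hunion : Set.Icc 0 (t (i + 1) : ℝ) =
          Set.Icc 0 (t i : ℝ) ∪ Set.Icc (t i : ℝ) (t (i + 1)) :=
        (Set.Icc_union_Icc_eq_Icc h0i hle).symm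
      refine ⟨Γ₁, ?_, ?_, ?_⟩
      · rw [hunion]
        exact (hΓ.congr e1).union_of_isClosed (hΓ'.congr e2) isClosed_Icc isClosed_Icc
      · rw [e1 0 ⟨le_rfl, h0i⟩, hΓ0]
      · intro s hs
        rw [hunion] at hs
        rcases hs with hs | hs
        · rw [e1 s hs, hΓa s hs]
        · rw [e2 s hs, hΓ'a s hs]
  obtain ⟨Γ, hΓ, hΓ0, hΓa⟩ := key n
  rw [hn n le_rfl] at hΓ hΓa
  refine ⟨⟨fun s => Γ s, ?_⟩, hΓ0, fun s => ?_⟩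
  · exact hΓ.comp_continuous continuous_subtype_val fun s => s.2
  · exact (hΓa s s.2).trans (hgγ s)

end PathLifting

/-! ### Algebraic germs -/

section RootGerms

variable {N : ℕ}

/-- Germs of matrix functions whose entries are roots of given polynomials. -/
def IsRootGerm (P : Fin N → Fin N → Polynomial (Polynomial ℂ)) (k : ℂ)
    (F : ℂ → Matrix (Fin N) (Fin N) ℂ) : Prop :=
  MatMeromorphicAt F k ∧ ∀ i j, ∀ᶠ w in 𝓝[≠] k, (P i j).evalEval w (F w i j) = 0

/-- The product of the Puiseux exponents of the entries serves all entries. The branches remain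
roots because the polynomial equation spreads over the disc by the identity theorem. -/
theorem exists_isLocallyUniformized_isRootGerm {P : Fin N → Fin N → Polynomial (Polynomial ℂ)}
    (hP : ∀ i j, P i j ≠ 0) :
    ∃ M : ℕ, 0 < M ∧ IsLocallyUniformized (IsRootGerm P) fun _ => M := by
  choose M hM hexp using fun i j => hasPuiseuxExpansions (hP i j)
  let L := ∏ i, ∏ j, M i j
  have hL : 0 < L := Finset.prod_pos fun i _ => Finset.prod_pos fun j _ => hM i j
  have hdvd : ∀ i j, M i j ∣ L := fun i j =>
    (Finset.dvd_prod_of_mem _ (Finset.mem_univ j)).trans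
      (Finset.dvd_prod_of_mem (fun i => ∏ j, M i j) (Finset.mem_univ i))
  choose q' hq' using hdvd
  have hq : ∀ i j, ∃ q, 0 < q ∧ q * M i j = L := fun i j =>
    ⟨q' i j, Nat.pos_of_ne_zero fun h => hL.ne' (by rw [hq' i j, h, mul_zero]), by
      rw [hq' i j, mul_comm]⟩
  choose q hq0 hqL using hq
  refine ⟨L, hL, fun k₀ => ⟨hL, ?_⟩⟩
  choose r hr hexp using fun i j => hexp i j k₀
  obtain ⟨ρ, ⟨hρ1, hρr⟩, hρ⟩ : ∃ ρ : ℝ, (ρ < 1 ∧ ∀ i j, ρ < r i j) ∧ 0 < ρ := by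
    have : ∀ᶠ ρ in 𝓝[>] (0 : ℝ), ρ < 1 ∧ ∀ i j, ρ < r i j := by
      refine Eventually.filter_mono nhdsWithin_le_nhds ?_
      exact (gt_mem_nhds one_pos).and
        (eventually_all.2 fun i => eventually_all.2 fun j => gt_mem_nhds (hr i j))
    exact (this.and self_mem_nhdsWithin).exists
  have hpow : ∀ i j (z : ℂ), ‖z‖ < ρ → ‖z ^ q i j‖ < r i j := fun i j z hz => by
    rw [norm_pow]
    exact ((pow_le_of_le_one (norm_nonneg _) (hz.trans hρ1).le (hq0 i j).ne').trans_lt hz).trans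
      (hρr i j)
  refine ⟨ρ, hρ, fun z₁ hz₁ hz₁r F ⟨hF, hFP⟩ => ?_⟩
  have hex : ∀ i j, ∃ h : ℂ → ℂ, (∀ z, ‖z‖ < r i j → MeromorphicAt h z) ∧
      ∀ᶠ u in 𝓝[≠] (z₁ ^ q i j), F (k₀ + u ^ M i j) i j = h u := fun i j =>
    hexp i j (z₁ ^ q i j) (pow_ne_zero _ hz₁) (hpow i j z₁ hz₁r) (fun w => F w i j)
      (by rw [← pow_mul, hqL]; exact hF i j) (by rw [← pow_mul, hqL]; exact hFP i j)
  choose h hh hhF using hex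
  let H : ℂ → Matrix (Fin N) (Fin N) ℂ := fun z => Matrix.of fun i j => h i j (z ^ q i j)
  have hH : ∀ z, ‖z‖ < ρ → MatMeromorphicAt H z := fun z hz i j =>
    MeromorphicAt.comp_analyticAt (f := h i j) (g := fun z => z ^ q i j)
      (hh i j _ (hpow i j z hz)) (by fun_prop)
  have hFH : ∀ᶠ u in 𝓝[≠] z₁, F (k₀ + u ^ L) = H u := by
    have : ∀ i j, ∀ᶠ u in 𝓝[≠] z₁, F (k₀ + u ^ L) i j = h i j (u ^ q i j) := fun i j => by
      filter_upwards [(eventually_nhdsNE_pow_iff' (hq0 i j)).2 (hhF i j)] with u hu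
      rw [← hu, ← pow_mul, hqL]
    filter_upwards [eventually_all.2 fun i => eventually_all.2 (this i)] with u hu
    exact Matrix.ext hu
  refine ⟨H, hH, hFH, fun z hz hzr => ?_⟩
  obtain ⟨K, hK, hKH⟩ := (hH z hzr).exists_comp_pow_eq hL hz k₀
  refine ⟨K, ⟨hK, fun i j => ?_⟩, hKH.filter_mono nhdsWithin_le_nhds⟩
  rw [← eventually_nhdsNE_pow_iff hL]
  have h0 : ∀ᶠ u in 𝓝[≠] z, (P i j).evalEval (k₀ + u ^ L) (H u i j) = 0 := by
    refine eventually_eq_zero_of_preconnected (U := Metric.ball 0 ρ) (x := z₁)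
      (convex_ball _ _).isPreconnected (fun y hy => ?_) (by simpa using hz₁r) (by simpa using hzr) ?_
    · exact MeromorphicAt.evalEval (P i j) (hH y (by simpa using hy) i j) (by fun_prop)
    · have := (eventually_nhdsNE_pow_iff hL).2 (hFP i j)
      filter_upwards [this, hFH] with u a b
      rwa [← b]
  filter_upwards [h0, hKH.filter_mono nhdsWithin_le_nhds] with u a b
  rwa [b]

end RootGerms

/-! ### From a locally uniformized class to the Riemann surface of a function -/

section RiemannSurface

variable {N : ℕ} {Q : ℂ → Matrix (Fin N) (Fin N) ℂ} {U : Set ℂ}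
  {𝓐 : ℂ → (ℂ → Matrix (Fin N) (Fin N) ℂ) → Prop} {n : ℂ → ℕ}

open FunctionElement

theorem mk_mem_pointsOver_of_isGermOf {e : FunctionElement N} (he : IsGermOf e Q)
    (hQ : ∀ᶠ k in 𝓝[≠] e.affix, 𝓐 k Q) : SurfacePoint.mk e ∈ pointsOver 𝓐 := by
  rw [mk_mem_pointsOver_iff, he.1]
  have h1 : ∀ᶠ z in 𝓝[≠] (0 : ℂ), 𝓐 (e.affix + z ^ 1) Q := by
    rw [eventually_nhdsNE_pow_iff one_pos (p := fun w => 𝓐 w Q)]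
    simpa using hQ
  filter_upwards [h1, eventually_nhdsNE_eventually_nhds he.2] with z a b
  exact ⟨Q, a, (b.filter_mono nhdsWithin_le_nhds).mono fun u hu => by rw [pow_one, hu]⟩

theorem continuous_mk_ofFun (hQ : ∀ k ∈ U, MatMeromorphicAt Q k) :
    Continuous fun k : U => SurfacePoint.mk (ofFun Q k (hQ k k.2)) := by
  rw [continuous_iff_continuousAt]
  intro k
  refine SurfacePoint.tendsto_mk_of_hasBranchAt (ζ := fun k' : U => (k' - k : ℂ)) ?_ ?_
  · have : Continuous fun k' : U => (k' - k : ℂ) := by fun_prop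
    simpa using this.tendsto k
  · refine Eventually.of_forall fun k' => ?_
    by_cases h : k' = k
    · left; rw [h]
    refine Or.inr ⟨sub_ne_zero.2 (Subtype.coe_injective.ne h), _, rfl, rfl, ?_, ?_⟩
    · simp [ofFun]
    · refine Eventually.of_forall fun u => ?_
      simp only [ofFun, pow_one]
      congr 1; ring

theorem IsGermOf.mk_eq {e : FunctionElement N} (he : IsGermOf e Q)
    (hQ : MatMeromorphicAt Q e.affix) : SurfacePoint.mk e = SurfacePoint.mk (ofFun Q e.affix hQ) :=
  SurfacePoint.mk_eq_mk_of_order_one rfl he.1 rfl he.2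

/-- The germs of `Q` are a continuous image of the connected set `U`, hence lie in one component. -/
theorem riemannSurface_eq_connectedComponent (hU : IsPreconnected U)
    (hQ : ∀ k ∈ U, MatMeromorphicAt Q k) {k : ℂ} (hk : k ∈ U) :
    riemannSurface Q U = connectedComponent (SurfacePoint.mk (ofFun Q k (hQ k hk))) := by
  ext x
  refine ⟨?_, fun hx => ⟨_, hk, isGermOf_ofFun (hQ k hk), hx⟩⟩
  rintro ⟨e, heU, he, hx⟩
  rw [he.mk_eq (hQ _ heU)] at hx
  have : PreconnectedSpace U := Subtype.preconnectedSpace hU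
  have hpre := isPreconnected_range (continuous_mk_ofFun hQ)
  rwa [connectedComponent_eq
    (hpre.subset_connectedComponent ⟨⟨k, hk⟩, rfl⟩ ⟨⟨e.affix, heU⟩, rfl⟩)]

theorem mk_mem_riemannSurface {e : FunctionElement N} (heU : e.affix ∈ U) (he : IsGermOf e Q) :
    SurfacePoint.mk e ∈ riemannSurface Q U := ⟨e, heU, he, mem_connectedComponent⟩

theorem connectedComponent_subset_riemannSurface {x : SurfacePoint N}
    (hx : x ∈ riemannSurface Q U) : connectedComponent x ⊆ riemannSurface Q U := by
  obtain ⟨e, heU, he, hxe⟩ := hx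
  intro y hy
  exact ⟨e, heU, he, by rwa [connectedComponent_eq hxe]⟩

theorem riemannSurface_subset_pointsOver (hA : IsLocallyUniformized 𝓐 n)
    (hQA : ∀ k ∈ U, ∀ᶠ w in 𝓝[≠] k, 𝓐 w Q) : riemannSurface Q U ⊆ pointsOver 𝓐 := by
  rintro x ⟨e, heU, he, hx⟩
  exact (isClopen_pointsOver hA).connectedComponent_subset
    (mk_mem_pointsOver_of_isGermOf he (hQA _ heU)) hx

/-- The surface of `Q` lies in the clopen set `pointsOver 𝓐`, where paths lift and orders divide
`n`; a lifted path stays in its component. -/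
theorem continuesWithBranching_of_isLocallyUniformized (hU : IsConnected U)
    (hQ : ∀ k ∈ U, MatMeromorphicAt Q k) (hA : IsLocallyUniformized 𝓐 n)
    (hQA : ∀ k ∈ U, ∀ᶠ w in 𝓝[≠] k, 𝓐 w Q) {T : Set ℂ} (hT : ∀ k, k ∉ T → n k = 1) :
    ContinuesWithBranching Q U T n where
  connected := by
    obtain ⟨k, hk⟩ := hU.nonempty
    rw [riemannSurface_eq_connectedComponent hU.isPreconnected hQ hk]
    exact isConnected_connectedComponent
  extends_function k hk :=
    ⟨_, rfl, isGermOf_ofFun (hQ k hk), mk_mem_riemannSurface hk (isGermOf_ofFun (hQ k hk))⟩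
  continuation x hx γ hγx hγ := by
    obtain ⟨Γ, hΓ0, hΓ⟩ := exists_lift_of_mem_pointsOver hA hT
      (riemannSurface_subset_pointsOver hA hQA hx) γ hγx hγ
    refine ⟨Γ, hΓ0, fun t => ⟨connectedComponent_subset_riemannSurface hx ?_, hΓ t⟩⟩
    exact (isPreconnected_range Γ.continuous).subset_connectedComponent ⟨0, hΓ0⟩ ⟨t, rfl⟩
  branch_affix x hx := by
    by_contra hxT
    have := order_dvd_of_mem_pointsOver hA (riemannSurface_subset_pointsOver hA hQA hx.1)
    rw [hT _ hxT, Nat.dvd_one] at this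
    have h2 := hx.2
    omega
  branch_order x hx := ⟨(hA _).1,
    order_dvd_of_mem_pointsOver hA (riemannSurface_subset_pointsOver hA hQA hx.1)⟩

end RiemannSurface

/-! ### Lowering the exponents to multiples of the actual orders -/

section SurfaceGerms

variable {N : ℕ}

/-- Germs of functions which are ordinary points of a part `S` of the surface. -/
def IsSurfaceGerm (S : Set (SurfacePoint N)) (k : ℂ) (F : ℂ → Matrix (Fin N) (Fin N) ℂ) : Prop :=
  ∃ e : FunctionElement N, SurfacePoint.mk e ∈ S ∧ e.order = 1 ∧ e.affix = k ∧
    ∀ᶠ w in 𝓝[≠] (0 : ℂ), e.toFun w = F (k + w)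

/-- A union of components of the surface is uniformized by exponents that are multiples of the
orders of its points. -/
theorem isLocallyUniformized_isSurfaceGerm {𝓡 : ℂ → (ℂ → Matrix (Fin N) (Fin N) ℂ) → Prop} {M : ℕ}
    (hR : IsLocallyUniformized 𝓡 fun _ => M) {S : Set (SurfacePoint N)} (hS : S ⊆ pointsOver 𝓡)
    (hSc : ∀ x ∈ S, connectedComponent x ⊆ S) {n : ℂ → ℕ} (hn : ∀ k, 0 < n k)
    (hdvd : ∀ x ∈ S, x.order ∣ n x.affix) : IsLocallyUniformized (IsSurfaceGerm S) n := by
  intro k₀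
  obtain ⟨hM, r, hr, hA⟩ := hR k₀
  beta_reduce at hM hA
  have hn0 := hn k₀
  refine ⟨hn0, min 1 (r ^ M), lt_min one_pos (pow_pos hr _), fun z₁ hz₁ hz₁r F hF => ?_⟩
  obtain ⟨e, heS, heo, hea, heF⟩ := hF
  have hpow : ∀ z : ℂ, ‖z‖ < min 1 (r ^ M) → ‖z‖ ^ n k₀ < r ^ M := fun z hz =>
    (pow_le_of_le_one (norm_nonneg _) (hz.le.trans (min_le_left _ _)) hn0.ne').trans_lt
      (hz.trans_le (min_le_right _ _))
  -- The same affix is reached by `z₂` for the exponent `M` and by `z₁` for `n k₀`; the disc is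
  -- known for `M`.
  obtain ⟨z₂, hz₂⟩ := exists_pow_eq hM (z₁ ^ n k₀)
  have hz₂0 : z₂ ≠ 0 := by
    rintro rfl
    rw [zero_pow hM.ne'] at hz₂
    exact pow_ne_zero _ hz₁ hz₂.symm
  have hz₂r : ‖z₂‖ < r := by
    refine lt_of_pow_lt_pow_left₀ M hr.le ?_
    rw [← norm_pow, hz₂, norm_pow]; exact hpow z₁ hz₁r
  obtain ⟨Φ, e₀, d, D, hΦ⟩ := exists_surface_disc_through k₀ hM hr hA (hS heS) hz₂r
    (by rw [hz₂]; exact hea)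
  have hΦS : ∀ z, ‖z‖ < r → Φ z ∈ S := fun z hz => by
    refine hSc _ heS ?_
    rw [← hΦ]
    exact ((convex_ball (0 : ℂ) r).isPreconnected.image Φ D.continuousOn).subset_connectedComponent
      ⟨z₂, by simpa using hz₂r, rfl⟩ ⟨z, by simpa using hz, rfl⟩
  obtain ⟨q, hq⟩ : e₀.order ∣ n k₀ := by
    have := hdvd _ (hΦS 0 (by simpa using hr))
    rw [D.center] at this
    have h2 : e₀.order ∣ n e₀.affix := this
    rwa [D.center_affix] at h2
  have hm := e₀.order_pos
  have hq0 : 0 < q := Nat.pos_of_ne_zero fun h => hn0.ne' (by rw [hq, h, mul_zero])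
  have hqm : q * e₀.order = n k₀ := by rw [hq, mul_comm]
  have hz₁q : z₁ ^ q ≠ 0 := pow_ne_zero _ hz₁
  -- The central parameter is `z₂ ^ d` in one description and `z₁ ^ q` in the other; `ω`, a root of
  -- unity of the central order, aligns them.
  let ω : ℂ := z₂ ^ d / z₁ ^ q
  have hωz : ω * z₁ ^ q = z₂ ^ d := div_mul_cancel₀ _ hz₁q
  have hω : ω ^ e₀.order = 1 := by
    simp only [ω]
    rw [div_pow, ← pow_mul, ← pow_mul, D.mul_order, hqm, hz₂, div_self (pow_ne_zero _ hz₁)]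
  have hω1 : ‖ω‖ = 1 := Complex.norm_eq_one_of_pow_eq_one hω hm.ne'
  have hω0 : ω ≠ 0 := e₀.ne_zero_of_pow_eq_one hω
  have hωr : ∀ z : ℂ, ‖z‖ < min 1 (r ^ M) → ‖ω * z ^ q‖ < r ^ d := fun z hz => by
    refine lt_of_pow_lt_pow_left₀ e₀.order (pow_nonneg hr.le _) ?_
    rw [norm_mul, hω1, one_mul, norm_pow, ← pow_mul, ← pow_mul, hqm, D.mul_order]
    exact hpow z hz
  have hmove : ∀ (𝓑 : ℂ → (ℂ → Matrix (Fin N) (Fin N) ℂ) → Prop) (z z' : ℂ),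
      z' ^ d = ω * z ^ q → HasBranchIn 𝓑 k₀ M (fun t => e₀.toFun (t ^ d)) z' →
      HasBranchIn 𝓑 k₀ (n k₀) (fun t => e₀.toFun (ω * t ^ q)) z := by
    intro 𝓑 z z' hz' hb
    rw [← D.mul_order, hasBranchIn_comp_pow_iff D.d_pos, hz'] at hb
    rw [← hqm]
    exact (hasBranchIn_comp_pow_iff hq0 (h := fun t => e₀.toFun (ω * t))).2
      ((hasBranchIn_comp_mul_iff hω hω0).2 hb)
  have hbranch : ∀ (z : ℂ) (e' : FunctionElement N), (∀ᶠ u in 𝓝[≠] z,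
      e'.toFun (u ^ M - z ^ M) = e₀.toFun (u ^ d)) → ∀ᶠ u in 𝓝[≠] z,
      e'.toFun (k₀ + u ^ M - (k₀ + z ^ M)) = e₀.toFun (u ^ d) := fun z e' h => by
    simpa only [add_sub_add_left_eq_sub] using h
  refine ⟨fun t => e₀.toFun (ω * t ^ q), fun z hz => ?_, ?_, fun z hz hzr => ?_⟩
  · exact MatMeromorphicAt.comp_analyticAt (g := fun t => ω * t ^ q)
      (D.meromorphic _ (hωr z hz)) (by fun_prop)
  · obtain ⟨e', hΦe', ho', ha', he'⟩ := D.branch z₂ hz₂0 hz₂r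
    -- `hmove` is used here with the class of germs equal to that of `F`, which turns it into a
    -- statement about this one germ.
    obtain ⟨F', hF'F, hF'⟩ := hmove (fun k F' => ∀ᶠ w in 𝓝[≠] k, F' w = F w) z₁ z₂ hωz.symm
      ⟨fun w => e'.toFun (w - (k₀ + z₂ ^ M)), by
        obtain ⟨-, -, ζ, hζ, hev⟩ := Quotient.exact (hΦ.symm.trans hΦe')
        rw [heo, pow_one] at hζ
        subst hζ
        simp only [one_mul] at hev
        rw [show k₀ + z₂ ^ M = (k₀ + z₂ ^ M) + 0 by ring,
          ← eventually_nhdsNE_add_iff]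
        filter_upwards [hev, heF] with w a b
        rw [add_zero, add_sub_cancel_left, a, b, hz₂], hbranch _ _ he'⟩
    filter_upwards [hF', (eventually_nhdsNE_pow_iff hn0).2 hF'F] with u a b
    rw [← b, a]
  · obtain ⟨z', hz'⟩ := exists_pow_eq D.d_pos (ω * z ^ q)
    have hz'0 : z' ≠ 0 := by
      rintro rfl
      rw [zero_pow D.d_pos.ne'] at hz'
      exact mul_ne_zero hω0 (pow_ne_zero _ hz) hz'.symm
    have hz'r : ‖z'‖ < r := by
      refine lt_of_pow_lt_pow_left₀ d hr.le ?_
      rw [← norm_pow, hz']; exact hωr z hzr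
    obtain ⟨e', hΦe', ho', ha', he'⟩ := D.branch z' hz'0 hz'r
    refine hmove _ z z' hz' ⟨fun w => e'.toFun (w - (k₀ + z' ^ M)), ⟨e', ?_, ho', ha', ?_⟩,
      hbranch _ _ he'⟩
    · rw [← hΦe']; exact hΦS z' hz'r
    · exact Eventually.of_forall fun w => by simp only [add_sub_cancel_left]

end SurfaceGerms

/-! ### The class generated by the germs of `G` and the two factors -/

section Uniformization

variable {N : ℕ} {𝓐 : ℂ → (ℂ → Matrix (Fin N) (Fin N) ℂ) → Prop} {k₀ z z₁ : ℂ} {n : ℕ} {r : ℝ}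
  {F H : ℂ → Matrix (Fin N) (Fin N) ℂ}

/-- The germ of `F` at `k₀ + z₁ ^ n` is a branch of a function, meromorphic in the disc of radius `r`,
of the parameter `z` with `k = k₀ + z ^ n`, whose branches all belong to the class `𝓐`. -/
def IsUniformizedBy (𝓐 : ℂ → (ℂ → Matrix (Fin N) (Fin N) ℂ) → Prop) (k₀ : ℂ) (n : ℕ) (r : ℝ)
    (z₁ : ℂ) (F : ℂ → Matrix (Fin N) (Fin N) ℂ) : Prop :=
  ∃ h : ℂ → Matrix (Fin N) (Fin N) ℂ, (∀ z, ‖z‖ < r → MatMeromorphicAt h z) ∧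
    (∀ᶠ u in 𝓝[≠] z₁, F (k₀ + u ^ n) = h u) ∧
    ∀ z, z ≠ 0 → ‖z‖ < r → HasBranchIn 𝓐 k₀ n h z

theorem IsUniformizedBy.mul (hF : IsUniformizedBy 𝓐 k₀ n r z₁ F)
    (hH : IsUniformizedBy 𝓐 k₀ n r z₁ H)
    (h𝓐 : ∀ k F H, 𝓐 k F → 𝓐 k H → 𝓐 k fun w => F w * H w) :
    IsUniformizedBy 𝓐 k₀ n r z₁ fun w => F w * H w := by
  obtain ⟨f, hf, hFf, hfb⟩ := hF
  obtain ⟨g, hg, hHg, hgb⟩ := hH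
  refine ⟨fun u => f u * g u, fun z hz => (hf z hz).mul (hg z hz), ?_, fun z hz hzr => ?_⟩
  · filter_upwards [hFf, hHg] with u a b
    rw [a, b]
  · obtain ⟨A, hA, hAf⟩ := hfb z hz hzr
    obtain ⟨B, hB, hBg⟩ := hgb z hz hzr
    refine ⟨_, h𝓐 _ A B hA hB, ?_⟩
    filter_upwards [hAf, hBg] with u a b
    rw [a, b]

theorem IsUniformizedBy.inv (hF : IsUniformizedBy 𝓐 k₀ n r z₁ F)
    (h𝓐 : ∀ k F, 𝓐 k F → 𝓐 k fun w => (F w)⁻¹) :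
    IsUniformizedBy 𝓐 k₀ n r z₁ fun w => (F w)⁻¹ := by
  obtain ⟨f, hf, hFf, hfb⟩ := hF
  refine ⟨fun u => (f u)⁻¹, fun z hz => (hf z hz).inv, ?_, fun z hz hzr => ?_⟩
  · filter_upwards [hFf] with u a
    rw [a]
  · obtain ⟨A, hA, hAf⟩ := hfb z hz hzr
    exact ⟨_, h𝓐 _ A hA, hAf.mono fun u a => by rw [a]⟩

theorem IsUniformizedBy.congr (hF : IsUniformizedBy 𝓐 k₀ n r z₁ F) (hn : 0 < n)
    (h : ∀ᶠ w in 𝓝[≠] (k₀ + z₁ ^ n), F w = H w) : IsUniformizedBy 𝓐 k₀ n r z₁ H := by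
  obtain ⟨f, hf, hFf, hfb⟩ := hF
  refine ⟨f, hf, ?_, hfb⟩
  filter_upwards [hFf, (eventually_nhdsNE_pow_iff hn).2 h] with u a b
  rw [← b, a]

theorem isUniformizedBy_of_forall {V : Set ℂ} (hF : ∀ k ∈ V, MatMeromorphicAt F k)
    (hV : ∀ z, ‖z‖ < r → k₀ + z ^ n ∈ V) (h𝓐 : ∀ k ∈ V, 𝓐 k F) :
    IsUniformizedBy 𝓐 k₀ n r z₁ F :=
  ⟨fun u => F (k₀ + u ^ n), fun z hz => MatMeromorphicAt.comp_analyticAt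
    (g := fun u => k₀ + u ^ n) (hF _ (hV z hz)) (by fun_prop), Eventually.of_forall fun _ => rfl,
    fun z _ hzr => ⟨F, h𝓐 _ (hV z hzr), Eventually.of_forall fun _ => rfl⟩⟩

/-- The germs obtained by multiplication and inversion from the germs of a class and those of two
functions on given domains. -/
inductive GeneratedGerm (𝓢 : ℂ → (ℂ → Matrix (Fin N) (Fin N) ℂ) → Prop) (V₁ V₂ : Set ℂ)
    (Q₁ Q₂ : ℂ → Matrix (Fin N) (Fin N) ℂ) : ℂ → (ℂ → Matrix (Fin N) (Fin N) ℂ) → Prop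
  | base {k F} : 𝓢 k F → GeneratedGerm 𝓢 V₁ V₂ Q₁ Q₂ k F
  | left {k} : k ∈ V₁ → GeneratedGerm 𝓢 V₁ V₂ Q₁ Q₂ k Q₁
  | right {k} : k ∈ V₂ → GeneratedGerm 𝓢 V₁ V₂ Q₁ Q₂ k Q₂
  | mul {k F H} : GeneratedGerm 𝓢 V₁ V₂ Q₁ Q₂ k F → GeneratedGerm 𝓢 V₁ V₂ Q₁ Q₂ k H →
      GeneratedGerm 𝓢 V₁ V₂ Q₁ Q₂ k fun w => F w * H w
  | inv {k F} : GeneratedGerm 𝓢 V₁ V₂ Q₁ Q₂ k F → GeneratedGerm 𝓢 V₁ V₂ Q₁ Q₂ k fun w => (F w)⁻¹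

/-- Near `k₀ ∈ V₁` the function `Q₁` is meromorphic in `k`, hence in `z`, and where `Q₂` is also
given it equals `Q₁⁻¹ * G`; symmetrically for `k₀ ∈ V₂`. Products and inverses keep the disc, so one
radius serves words of any length. -/
theorem isLocallyUniformized_generatedGerm {𝓢 : ℂ → (ℂ → Matrix (Fin N) (Fin N) ℂ) → Prop}
    {ν : ℂ → ℕ} (h𝓢 : IsLocallyUniformized 𝓢 ν) {V₁ V₂ : Set ℂ} (hV₁ : IsOpen V₁)
    (hV₂ : IsOpen V₂) (hV : ∀ k, k ∈ V₁ ∨ k ∈ V₂) {Q₁ Q₂ G : ℂ → Matrix (Fin N) (Fin N) ℂ}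
    (hQ₁ : ∀ k ∈ V₁, MatMeromorphicAt Q₁ k) (hQ₂ : ∀ k ∈ V₂, MatMeromorphicAt Q₂ k)
    (hG : ∀ k ∈ V₁, k ∈ V₂ → 𝓢 k G)
    (hfac : ∀ k ∈ V₁, k ∈ V₂ → ∀ᶠ w in 𝓝[≠] k, G w = Q₁ w * Q₂ w ∧ (G w).det ≠ 0) :
    IsLocallyUniformized (GeneratedGerm 𝓢 V₁ V₂ Q₁ Q₂) ν := by
  intro k₀
  obtain ⟨hn, r, hr, hA⟩ := h𝓢 k₀
  have hbase : ∀ ρ ≤ r, ∀ z₁ : ℂ, z₁ ≠ 0 → ‖z₁‖ < ρ → ∀ F, 𝓢 (k₀ + z₁ ^ ν k₀) F →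
      IsUniformizedBy (GeneratedGerm 𝓢 V₁ V₂ Q₁ Q₂) k₀ (ν k₀) ρ z₁ F := by
    intro ρ hρ z₁ hz₁ hz₁r F hF
    obtain ⟨h, hh, hFh, hb⟩ := hA z₁ hz₁ (hz₁r.trans_le hρ) F hF
    refine ⟨h, fun z hz => hh z (hz.trans_le hρ), hFh, fun z hz hzr => ?_⟩
    obtain ⟨A, hA, hAh⟩ := hb z hz (hzr.trans_le hρ)
    exact ⟨A, .base hA, hAh⟩
  have hsmall : ∀ V : Set ℂ, IsOpen V → k₀ ∈ V →
      ∃ ρ, 0 < ρ ∧ ρ ≤ r ∧ ∀ z : ℂ, ‖z‖ < ρ → k₀ + z ^ ν k₀ ∈ V := by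
    intro V hVo hk
    have hc : Continuous fun z : ℂ => k₀ + z ^ ν k₀ := by fun_prop
    have : ∀ᶠ z in 𝓝 (0 : ℂ), k₀ + z ^ ν k₀ ∈ V :=
      hc.continuousAt.eventually_mem (hVo.mem_nhds (by simpa [hn.ne'] using hk))
    obtain ⟨ρ, hρ, hball⟩ := Metric.eventually_nhds_iff_ball.1 this
    exact ⟨min ρ r, lt_min hρ hr, min_le_right _ _, fun z hz =>
      hball z (by simpa using hz.trans_le (min_le_left _ _))⟩
  have hgen : ∀ ρ ≤ r, ∀ z₁ : ℂ, z₁ ≠ 0 → ‖z₁‖ < ρ →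
      (k₀ + z₁ ^ ν k₀ ∈ V₁ →
        IsUniformizedBy (GeneratedGerm 𝓢 V₁ V₂ Q₁ Q₂) k₀ (ν k₀) ρ z₁ Q₁) →
      (k₀ + z₁ ^ ν k₀ ∈ V₂ →
        IsUniformizedBy (GeneratedGerm 𝓢 V₁ V₂ Q₁ Q₂) k₀ (ν k₀) ρ z₁ Q₂) →
      ∀ F, GeneratedGerm 𝓢 V₁ V₂ Q₁ Q₂ (k₀ + z₁ ^ ν k₀) F →
        IsUniformizedBy (GeneratedGerm 𝓢 V₁ V₂ Q₁ Q₂) k₀ (ν k₀) ρ z₁ F := by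
    intro ρ hρ z₁ hz₁ hz₁r h1 h2 F hF
    generalize hk : k₀ + z₁ ^ ν k₀ = k at hF
    induction hF with
    | base h => exact hbase ρ hρ z₁ hz₁ hz₁r _ (by rw [hk]; exact h)
    | left h => exact h1 (by rw [hk]; exact h)
    | right h => exact h2 (by rw [hk]; exact h)
    | mul _ _ ih ih' => exact ih.mul ih' fun _ _ _ => .mul
    | inv _ ih => exact ih.inv fun _ _ => .inv
  have hunit : ∀ k ∈ V₁, k ∈ V₂ → (∀ᶠ w in 𝓝[≠] k, (Q₁ w)⁻¹ * G w = Q₂ w) ∧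
      ∀ᶠ w in 𝓝[≠] k, G w * (Q₂ w)⁻¹ = Q₁ w := by
    intro k hk1 hk2
    have hw : ∀ᶠ w in 𝓝[≠] k, (Q₁ w)⁻¹ * G w = Q₂ w ∧ G w * (Q₂ w)⁻¹ = Q₁ w := by
      filter_upwards [hfac k hk1 hk2] with w ⟨a, b⟩
      rw [a, Matrix.det_mul] at b
      rw [a]
      exact ⟨Matrix.nonsing_inv_mul_cancel_left _ _ (left_ne_zero_of_mul b).isUnit,
        Matrix.mul_nonsing_inv_cancel_right _ _ (right_ne_zero_of_mul b).isUnit⟩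
    exact ⟨hw.mono fun _ h => h.1, hw.mono fun _ h => h.2⟩
  refine ⟨hn, ?_⟩
  rcases hV k₀ with hk | hk
  · obtain ⟨ρ, hρ, hρr, hball⟩ := hsmall V₁ hV₁ hk
    refine ⟨ρ, hρ, fun z₁ hz₁ hz₁r => ?_⟩
    have h1 : IsUniformizedBy (GeneratedGerm 𝓢 V₁ V₂ Q₁ Q₂) k₀ (ν k₀) ρ z₁ Q₁ :=
      isUniformizedBy_of_forall hQ₁ hball fun _ => .left
    refine hgen ρ hρr z₁ hz₁ hz₁r (fun _ => h1) fun hk2 => ?_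
    have hk1 := hball z₁ hz₁r
    exact ((h1.inv fun _ _ => .inv).mul (hbase ρ hρr z₁ hz₁ hz₁r G (hG _ hk1 hk2))
      fun _ _ _ => .mul).congr hn (hunit _ hk1 hk2).1
  · obtain ⟨ρ, hρ, hρr, hball⟩ := hsmall V₂ hV₂ hk
    refine ⟨ρ, hρ, fun z₁ hz₁ hz₁r => ?_⟩
    have h2 : IsUniformizedBy (GeneratedGerm 𝓢 V₁ V₂ Q₁ Q₂) k₀ (ν k₀) ρ z₁ Q₂ :=
      isUniformizedBy_of_forall hQ₂ hball fun _ => .right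
    refine hgen ρ hρr z₁ hz₁ hz₁r (fun hk1 => ?_) fun _ => h2
    have hk2 := hball z₁ hz₁r
    exact ((hbase ρ hρr z₁ hz₁ hz₁r G (hG _ hk1 hk2)).mul (h2.inv fun _ _ => .inv)
      fun _ _ _ => .mul).congr hn (hunit _ hk1 hk2).2

end Uniformization

theorem eventually_codiscreteWithin_iff {U : Set ℂ} (hU : IsOpen U) {p : ℂ → Prop} :
    (∀ᶠ k in codiscreteWithin U, p k) ↔ ∀ k ∈ U, ∀ᶠ w in 𝓝[≠] k, p w := by
  unfold Filter.Eventually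
  rw [mem_codiscreteWithin_iff_forall_mem_nhdsNE]
  refine forall₂_congr fun k hk => ⟨fun h => ?_, fun h => mem_of_superset h Set.subset_union_left⟩
  filter_upwards [h, nhdsWithin_le_nhds (hU.mem_nhds hk)] with w a b
  exact a.resolve_right fun c => c b

/-! ### The least common multiple of the orders at an affix -/

section AffixOrder

variable {N : ℕ} {G : ℂ → Matrix (Fin N) (Fin N) ℂ} {U : Set ℂ}

/-- The common multiple `M` makes the set nonempty, so the infimum is attained and is not the
default value `0`. -/
theorem affixOrder_spec {M : ℕ} (hM : 0 < M) (h : ∀ x ∈ riemannSurface G U, x.order ∣ M) (τ : ℂ) :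
    0 < affixOrder G U τ ∧ ∀ x ∈ branchPoints G U, x.affix = τ → x.order ∣ affixOrder G U τ :=
  Nat.sInf_mem (s := {n : ℕ | 0 < n ∧ ∀ x ∈ branchPoints G U, x.affix = τ → x.order ∣ n})
    ⟨M, hM, fun x hx _ => h x hx.1⟩

theorem order_dvd_affixOrder {M : ℕ} (hM : 0 < M) (h : ∀ x ∈ riemannSurface G U, x.order ∣ M)
    {x : SurfacePoint N} (hx : x ∈ riemannSurface G U) : x.order ∣ affixOrder G U x.affix := by
  rcases lt_or_ge x.order 2 with h2 | h2
  · have := Nat.pos_of_dvd_of_pos (h x hx) hM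
    rw [show x.order = 1 by omega]
    exact one_dvd _
  · exact (affixOrder_spec hM h _).2 x ⟨hx, h2⟩ rfl

/-- Without branch points over `τ` the divisibility condition is vacuous and `1` is admissible. -/
theorem affixOrder_eq_one {M : ℕ} (hM : 0 < M) (h : ∀ x ∈ riemannSurface G U, x.order ∣ M) {τ : ℂ}
    (hτ : τ ∉ branchAffixes G U) : affixOrder G U τ = 1 := by
  have h1 := (affixOrder_spec hM h τ).1
  have h2 : affixOrder G U τ ≤ 1 :=
    Nat.sInf_le ⟨one_pos, fun x hx hxτ => absurd ⟨x, hx, hxτ⟩ hτ⟩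
  omega

end AffixOrder

/-! ### The factors of `G` -/

theorem mainTheorem2 {N : ℕ} {ε : ℝ} (hε : 0 < ε)
    (G Qp Qm : ℂ → Matrix (Fin N) (Fin N) ℂ)
    (hG : IsAlgebraicMatrix G (strip ε))
    (hdet : ¬ ∀ᶠ k in codiscreteWithin (strip ε), (G k).det = 0)
    (hQ : IsFactorization ε G Qp Qm) :
    ContinuesWithBranching Qp (upperDomain ε)
        (branchAffixes G (strip ε)) (affixOrder G (strip ε)) ∧
      ContinuesWithBranching Qm (lowerDomain ε)
        (branchAffixes G (strip ε)) (affixOrder G (strip ε)) := by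
  have hUo : IsOpen (upperDomain ε) := isOpen_lt continuous_const Complex.continuous_im
  have hLo : IsOpen (lowerDomain ε) := isOpen_lt Complex.continuous_im continuous_const
  have hSo : IsOpen (strip ε) := hUo.inter hLo
  have hUc : Convex ℝ (upperDomain ε) := convex_halfSpace_im_gt _
  have hLc : Convex ℝ (lowerDomain ε) := convex_halfSpace_im_lt _
  have hSp : IsPreconnected (strip ε) := (hUc.inter hLc).isPreconnected
  have hU0 : (0 : ℂ) ∈ upperDomain ε := by
    change -ε < (0 : ℂ).im
    simpa using hε
  have hL0 : (0 : ℂ) ∈ lowerDomain ε := by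
    change (0 : ℂ).im < ε
    simpa using hε
  have hfac := (eventually_codiscreteWithin_iff hSo).1 hQ.factorization
  have hGm : ∀ k ∈ strip ε, MatMeromorphicAt G k := fun k hk =>
    ((hQ.meromorphic_plus k hk.1).mul (hQ.meromorphic_minus k hk.2)).congr
      ((hfac k hk).mono fun w hw => hw.symm)
  -- The strip is connected, so a determinant vanishing near one point would vanish identically.
  have hdet' : ∀ k ∈ strip ε, ∀ᶠ w in 𝓝[≠] k, (G w).det ≠ 0 := by
    intro k hk
    refine (hGm k hk).det.eventually_eq_zero_or_eventually_ne_zero.resolve_left fun h => hdet ?_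
    exact (eventually_codiscreteWithin_iff hSo).2 fun k' hk' =>
      eventually_eq_zero_of_preconnected hSp (fun z hz => (hGm z hz).det) hk hk' h
  choose P hP hPG using hG
  obtain ⟨M, hM, hA⟩ := exists_isLocallyUniformized_isRootGerm hP
  have hGP : ∀ k ∈ strip ε, IsRootGerm P k G := fun k hk =>
    ⟨hGm k hk, fun i j => (eventually_codiscreteWithin_iff hSo).1 (hPG i j) k hk⟩
  have hSP : riemannSurface G (strip ε) ⊆ pointsOver (IsRootGerm P) :=
    riemannSurface_subset_pointsOver hA fun k hk =>
      nhdsWithin_le_nhds (mem_of_superset (hSo.mem_nhds hk) hGP)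
  have hord : ∀ x ∈ riemannSurface G (strip ε), x.order ∣ M := fun x hx =>
    order_dvd_of_mem_pointsOver hA (hSP hx)
  -- All sheets of `G` enter here, as continuation of the factors may lead to any branch of `G` over
  -- the strip.
  have hS := isLocallyUniformized_isSurfaceGerm hA hSP
    (fun x hx => connectedComponent_subset_riemannSurface hx)
    (fun k => (affixOrder_spec hM hord k).1) fun x hx => order_dvd_affixOrder hM hord hx
  have hgen := isLocallyUniformized_generatedGerm hS hUo hLo
    (fun k => by
      rcases lt_or_ge k.im ε with h | h
      · exact Or.inr h
      · left
        change -ε < k.im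
        linarith)
    hQ.meromorphic_plus hQ.meromorphic_minus (G := G)
    (fun k hk hk' => ⟨.ofFun G k (hGm k ⟨hk, hk'⟩), mk_mem_riemannSurface (And.intro hk hk')
      (FunctionElement.isGermOf_ofFun _), rfl, rfl, Eventually.of_forall fun _ => rfl⟩)
    (fun k hk hk' => (hfac k ⟨hk, hk'⟩).and (hdet' k ⟨hk, hk'⟩))
  have hone : ∀ k, k ∉ branchAffixes G (strip ε) → affixOrder G (strip ε) k = 1 :=
    fun k hk => affixOrder_eq_one hM hord hk
  exact ⟨continuesWithBranching_of_isLocallyUniformized ⟨⟨0, hU0⟩, hUc.isPreconnected⟩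
      hQ.meromorphic_plus hgen
      (fun k hk => nhdsWithin_le_nhds (mem_of_superset (hUo.mem_nhds hk) fun _ => .left)) hone,
    continuesWithBranching_of_isLocallyUniformized ⟨⟨0, hL0⟩, hLc.isPreconnected⟩
      hQ.meromorphic_minus hgen
      (fun k hk => nhdsWithin_le_nhds (mem_of_superset (hLo.mem_nhds hk) fun _ => .right)) hone⟩
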